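/- For $\beta>0$ let $K_\beta$ be the Klein bottle obtained as the quotient of $\mathbb{C}=\mathbb{R}^2$ by the group generated by $\sigma:z\mapsto\bar z+\pi$ and $t:z\mapsto z+2i\beta$, and let $g_\beta$ be the flat metric it inherits. "Riemannian metric" means a continuous field of inner products. For such a metric $g$ on $K_\beta$ let $l_\sigma(g)$, $l_v(g)$, $l_h(g)$ be the least lengths (infima over rectifiable closed curves) of curves freely homotopic, respectively, to a loop closed by a glide reflection of horizontal displacement $\pi$ (that is, by $\sigma$ or by $t\sigma$), to a loop closed by the vertical translation $t$, and to a loop closed by the horizontal translation $\sigma^2$. Put $L_\sigma(g)=\min\{l_\sigma(g),l_h(g)\}$. **Theorem.** Let $\beta>0$. 1. If $\beta\le 2\ln(2+\sqrt3)$, then every Riemannian metric $g$ on $K_\beta$ conformal to $g_\beta$ satisfies $$L_\sigma(g)\,l_v(g)\le\frac{\arcsin\left(\frac{e^{\beta}-1}{e^{\beta}+1}\right)}{\frac{e^{\beta}-1}{e^{\beta}+1}}\,\mathrm{vol}(g).$$ Equality holds for some metric conformal to $g_\beta$ that is isometric to the spherical metric $f(v)^2du^2+dv^2$ on the quotient of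 the $(u,v)$-plane by $(u,v)\mapsto(u+\pi,-v)$ and $(u,v)\mapsto(u,v+4b)$, where $b\in(0,\pi/2)$ satisfies $\beta=2\ln\tan\left(\frac{\pi}{4}+\frac b2\right)$ and $f$ is the $2b$-periodic function equal to $\cos v$ for $|v|\le b$. 2. If $\beta>2\ln(2+\sqrt3)$, then every Riemannian metric $g$ on $K_\beta$ conformal to $g_\beta$ satisfies $$L_\sigma(g)\,l_v(g)\le\frac23\cdot\frac{3\beta+4\pi-6\ln(2+\sqrt3)}{4\sqrt3+\beta-2\ln(2+\sqrt3)}\,\mathrm{vol}(g).$$ Equality holds for some metric conformal to $g_\beta$ that is isometric to the flat-spherical metric $f(v)^2du^2+dv^2$ on the same quotient of the $(u,v)$-plane, where $b>\pi/3$ satisfies $\beta=2\ln(2+\sqrt3)+4\left(b-\frac\pi3\right)$ and $f$ is the $2b$-periodic function equal to $\cos v$ for $|v|\le\frac\pi3$ and to $\frac12$ for $\frac\pi3\le|v|\le b$. -/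

import Mathlib

namespace KleinBottle

noncomputable section

/-- The glide reflection `σ : z ↦ conj z + π` of the plane. -/
def glide (z : ℂ) : ℂ := (starRingEnd ℂ) z + (Real.pi : ℂ)

/-- The vertical translation `t : z ↦ z + 2iβ` of the plane. -/
def vert (β : ℝ) (z : ℂ) : ℂ := z + 2 * Complex.I * (β : ℂ)

/-- A (continuous) Riemannian metric on the Klein bottle `K`, the quotient of the plane by the
group generated by `glide` and `vert β`: a continuous field of inner products on the plane that is
invariant under both generators. The differential of `glide` is complex conjugation, that of
`vert β` is the identity. -/
structure Metric (β : ℝ) where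
  form : ℂ → LinearMap.BilinForm ℝ ℂ
  symm : ∀ z v w, form z v w = form z w v
  pos : ∀ z v, v ≠ 0 → 0 < form z v v
  continuous : ∀ v w, Continuous fun z => form z v w
  glide_invariant : ∀ z v w,
    form (glide z) ((starRingEnd ℂ) v) ((starRingEnd ℂ) w) = form z v w
  vert_invariant : ∀ z v w, form (vert β z) v w = form z v w

/-- The bilinear form `c² du² + dv²` on the tangent plane, with coordinates `u + iv`. -/
def warpedForm (c : ℝ) : LinearMap.BilinForm ℝ ℂ :=
  LinearMap.mk₂ ℝ (fun v w : ℂ => c ^ 2 * (v.re * w.re) + v.im * w.im)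
    (by intro a b c; simp; ring) (by intro a b c; simp; ring)
    (by intro a b c; simp; ring) (by intro a b c; simp; ring)

theorem warpedForm_apply (c : ℝ) (v w : ℂ) :
    warpedForm c v w = c ^ 2 * (v.re * w.re) + v.im * w.im := rfl

/-- The metric `f(v)² du² + dv²`, for `f` continuous, positive, even and `2β`-periodic, on the
quotient of the `(u, v)`-plane by `(u, v) ↦ (u + π, -v)` and `(u, v) ↦ (u, v + 2β)`. -/
def warped (β : ℝ) (f : ℝ → ℝ) (hc : Continuous f) (hpos : ∀ v, 0 < f v)
    (heven : ∀ v, f (-v) = f v) (hper : ∀ v, f (v + 2 * β) = f v) : Metric β where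
  form z := warpedForm (f z.im)
  symm z v w := by simp only [warpedForm_apply]; ring
  pos z v hv := by
    simp only [warpedForm_apply]
    have h := hpos z.im
    by_cases h0 : v.re = 0
    · have h1 : v.im ≠ 0 := fun h1 => hv (Complex.ext h0 h1)
      have := mul_self_pos.2 h1
      rw [h0]; linarith
    · have := mul_pos (pow_pos h 2) (mul_self_pos.2 h0)
      have := mul_self_nonneg v.im
      linarith
  continuous v w := by
    simp only [warpedForm_apply]
    fun_prop
  glide_invariant z v w := by
    simp [warpedForm_apply, glide, heven]
  vert_invariant z v w := by
    have : (vert β z).im = z.im + 2 * β := by simp [vert]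
    simp only [warpedForm_apply, this, hper]

/-- The flat metric `g_β`. -/
def flat (β : ℝ) : Metric β :=
  warped β (fun _ => 1) continuous_const (fun _ => one_pos) (fun _ => rfl) (fun _ => rfl)

/-- Distance from `v` to the nearest element of `2bℤ`
(Mathlib's quotient norm on the circle `ℝ / 2bℤ`). -/
def latticeDist (b v : ℝ) : ℝ := ‖(v : AddCircle (2 * b))‖

theorem latticeDist_continuous (b : ℝ) : Continuous (latticeDist b) :=
  (AddCircle.continuous_mk' (2 * b)).norm

theorem latticeDist_neg (b v : ℝ) : latticeDist b (-v) = latticeDist b v := by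
  simp [latticeDist]

theorem latticeDist_add (b v : ℝ) : latticeDist b (v + 2 * (2 * b)) = latticeDist b v := by
  have h : ((v + 2 * (2 * b) : ℝ) : AddCircle (2 * b)) = (v : AddCircle (2 * b)) := by
    rw [two_mul (2 * b), ← add_assoc, AddCircle.coe_add_period, AddCircle.coe_add_period]
  simp only [latticeDist, h]

theorem latticeDist_nonneg (b v : ℝ) : 0 ≤ latticeDist b v := norm_nonneg _

theorem latticeDist_le {b : ℝ} (hb : 0 < b) (v : ℝ) : latticeDist b v ≤ b := by
  have h := AddCircle.norm_le_half_period (2 * b) (x := (v : AddCircle (2 * b))) (by positivity)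
  rw [abs_of_pos (by positivity)] at h
  unfold latticeDist
  linarith

/-- The spherical metric `f(v)² du² + dv²`, `|u| ≤ π/2`, `|v| ≤ 2b`, where `f = cos` on
`|v| ≤ b` and `f` is `2b`-periodic. It has curvature one off the lines `v ∈ b + 2bℤ`. -/
def spherical (b : ℝ) (h0 : 0 < b) (h1 : b < Real.pi / 2) : Metric (2 * b) :=
  warped (2 * b) (fun v => Real.cos (latticeDist b v))
    (Real.continuous_cos.comp (latticeDist_continuous b))
    (fun v => Real.cos_pos_of_mem_Ioo
      ⟨by linarith [latticeDist_nonneg b v, Real.pi_pos], by linarith [latticeDist_le h0 v]⟩)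
    (fun v => by rw [latticeDist_neg])
    (fun v => by rw [latticeDist_add])

/-- The `2b`-periodic profile equal to `cos` on `|v| ≤ π/3` and to `1/2` on `π/3 ≤ |v| ≤ b`. -/
def flatSphericalProfile (b v : ℝ) : ℝ :=
  if latticeDist b v ≤ Real.pi / 3 then Real.cos (latticeDist b v) else 1 / 2

theorem flatSphericalProfile_eq (b v : ℝ) :
    flatSphericalProfile b v = Real.cos (min (latticeDist b v) (Real.pi / 3)) := by
  unfold flatSphericalProfile
  split_ifs with h
  · rw [min_eq_left h]
  · rw [min_eq_right (not_le.1 h).le, Real.cos_pi_div_three]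

theorem flatSphericalProfile_continuous (b : ℝ) : Continuous (flatSphericalProfile b) := by
  have h : flatSphericalProfile b =
      fun v => Real.cos (min (latticeDist b v) (Real.pi / 3)) :=
    funext (flatSphericalProfile_eq b)
  rw [h]
  exact Real.continuous_cos.comp ((latticeDist_continuous b).min continuous_const)

theorem flatSphericalProfile_pos (b v : ℝ) : 0 < flatSphericalProfile b v := by
  rw [flatSphericalProfile_eq]
  have hp := Real.pi_pos
  have h0 : 0 ≤ min (latticeDist b v) (Real.pi / 3) :=
    le_min (latticeDist_nonneg b v) (by positivity)
  have h1 := min_le_right (latticeDist b v) (Real.pi / 3)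
  exact Real.cos_pos_of_mem_Ioo ⟨by linarith, by linarith⟩

/-- The flat-spherical metric `f(v)² du² + dv²`, `|u| ≤ π/2`, `|v| ≤ 2b`, with
`f = flatSphericalProfile b`: round spherical caps `|v| ≤ π/3`, `2b - π/3 ≤ |v| ≤ 2b`, joined by
flat cylinders. -/
def flatSpherical (b : ℝ) : Metric (2 * b) :=
  warped (2 * b) (flatSphericalProfile b) (flatSphericalProfile_continuous b)
    (flatSphericalProfile_pos b)
    (fun v => by unfold flatSphericalProfile; rw [latticeDist_neg])
    (fun v => by unfold flatSphericalProfile; rw [latticeDist_add])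

namespace Metric

variable {β : ℝ}

/-- `g` is conformal to the flat metric `g_β`. -/
def IsConformal (g : Metric β) : Prop :=
  ∃ φ : ℂ → ℝ, (∀ z, 0 < φ z) ∧ ∀ z v w, g.form z v w = φ z * (flat β).form z v w

/-- The length of the (Lipschitz) curve `γ : [0, 1] → ℂ` for the metric `g`. -/
def length (g : Metric β) (γ : ℝ → ℂ) : ℝ :=
  ∫ s in (0 : ℝ)..1, Real.sqrt (g.form (γ s) (deriv γ s) (deriv γ s))

/-- The infimum of the lengths of the closed curves in the free homotopy class of the deck
transformation `τ`. A rectifiable closed curve of the quotient, in Lipschitz parametrization,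
belongs to this class exactly if it has a lift to the plane that joins some point `p` to `τ p`. -/
def leastLength (g : Metric β) (τ : ℂ → ℂ) : ℝ :=
  sInf {l : ℝ | ∃ γ : ℝ → ℂ, (∃ C, LipschitzOnWith C γ (Set.Icc 0 1)) ∧
    γ 1 = τ (γ 0) ∧ l = g.length γ}

/-- `l_σ`: least length of a curve closed by a glide reflection of horizontal displacement `π`.
These glide reflections are the `t^k σ`; they (together with their inverses, which are the same
curves with reversed orientation) form two classes, those of `σ` (axes `Im z ∈ 2βℤ`) and of `t σ`
(axes `Im z ∈ β + 2βℤ`). -/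
def lSigma (g : Metric β) : ℝ :=
  min (g.leastLength glide) (g.leastLength (vert β ∘ glide))

/-- `l_v`: least length in the class of the vertical translation `t`. -/
def lV (g : Metric β) : ℝ := g.leastLength (vert β)

/-- `l_h`: least length in the class of the horizontal translation `σ²`. -/
def lH (g : Metric β) : ℝ := g.leastLength (glide ∘ glide)

/-- `L_σ = min (l_σ, l_h)`. -/
def LSigma (g : Metric β) : ℝ := min g.lSigma g.lH

/-- The volume of the Klein bottle, computed on the fundamental domain `[0, π) × [0, 2β)`. -/
def vol (g : Metric β) : ℝ :=
  ∫ z in Set.Ico 0 Real.pi ×ℂ Set.Ico 0 (2 * β),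
    Real.sqrt (g.form z 1 1 * g.form z Complex.I Complex.I - g.form z 1 Complex.I ^ 2)

/-- `F` induces a `C¹` isometry between the Klein bottles with metrics `g` and `h`: it is a
`C¹` diffeomorphism of the plane, equivariant for the generators of the two groups, and the
pull-back of `h` is `g`. -/
def IsIsometry {β' : ℝ} (g : Metric β) (h : Metric β') (F : ℂ ≃ₜ ℂ) : Prop :=
  ContDiff ℝ 1 F ∧ ContDiff ℝ 1 F.symm ∧
  (∀ z, F (glide z) = glide (F z)) ∧ (∀ z, F (vert β z) = vert β' (F z)) ∧
  ∀ z v w, h.form (F z) (fderiv ℝ F z v) (fderiv ℝ F z w) = g.form z v w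

/-- The Klein bottles with metrics `g` and `h` are isometric. -/
def Isometric {β' : ℝ} (g : Metric β) (h : Metric β') : Prop :=
  ∃ F : ℂ ≃ₜ ℂ, g.IsIsometry h F

end Metric

/-- The constant for conformal types `β ≤ 2 ln (2 + √3)`. -/
def sphericalConst (β : ℝ) : ℝ :=
  Real.arcsin ((Real.exp β - 1) / (Real.exp β + 1)) / ((Real.exp β - 1) / (Real.exp β + 1))

/-- The constant for conformal types `β > 2 ln (2 + √3)`. -/
def flatSphericalConst (β : ℝ) : ℝ :=
  2 / 3 * ((3 * β + 4 * Real.pi - 6 * Real.log (2 + Real.sqrt 3)) /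
    (4 * Real.sqrt 3 + β - 2 * Real.log (2 + Real.sqrt 3)))

end

end KleinBottle

namespace KleinBottle

open MeasureTheory Set Filter Topology

/-! A metric conformal to g_β is ρ² g_β. It is controlled through m(y) (`profile`), the average of ρ
over the horizontal lines at heights y and y + β. Averaging test curves over horizontal translates
and over the two glide axes bounds L = L_σ and l = l_v above by integrals of m. Cauchy–Schwarz gives
4π ∫ m² ≤ vol over [0, β/2], which suffices because m is even and β-periodic.

In Mercator coordinates the unit sphere has density 1/cosh y and σ is the antipodal map. The curves
sinh y = t sin u are great circles, and half of one closes up under a glide reflection. The extremal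
density is p(y) = 1/cosh(min(y, a)) on [0, β/2]. Here a = β/2 for small β and cosh a = 2 for large
β: at higher latitudes the parallel, of length 2π/cosh y, would be shorter than π.

Put I = ∫ p², b = ∫ p, C = I/(2b), and split p = (p - C) + C. On the cap y < a, the part p - C is a
nonnegative superposition of great circles, found by solving an Abel equation
(`lintegral_semicircleKernel`, `mul_le_integral_of_le_greatCircle`). On the band y > a it is a
superposition of parallels. The constant C is a superposition of vertical lines. Hence ∫ m p ≥
(I/2)(L/π + l/(4b)), and Cauchy–Schwarz together with the arithmetic-geometric mean inequality gives
L l I ≤ b vol (`LSigma_mul_lV_le`).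

For sharpness, the metric with density p has vol = 4πI, and calibrating functions give L ≥ π and l ≥
4b (`le_leastLength`). These functions are a spherical angle after folding the plane onto |y| ≤ β/2,
the height ∫ p, and x/2. Replacing y by the height ∫ p is the isometry with the warped product of
the statement. -/

theorem lintegral_ofReal_of_hasDerivAt {G g : ℝ → ℝ} {a b : ℝ} (hab : a ≤ b)
    (hc : ContinuousOn G (Icc a b)) (hd : ∀ x ∈ Ioo a b, HasDerivAt G (g x) x)
    (h0 : ∀ x ∈ Ioo a b, 0 ≤ g x) :
    ∫⁻ x in Ioo a b, ENNReal.ofReal (g x) = ENNReal.ofReal (G b - G a) := by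
  -- A nonnegative derivative of a function continuous up to the endpoints is integrable; this
  -- absorbs the inverse square root singularities of the kernel below.
  have hi := intervalIntegral.integrableOn_deriv_of_nonneg hc hd h0
  have hi' : IntegrableOn g (Ioo a b) := hi.mono_set Ioo_subset_Ioc_self
  rw [← ofReal_integral_eq_lintegral_ofReal hi'
    ((ae_restrict_iff' measurableSet_Ioo).2 (Filter.Eventually.of_forall h0)),
    ← integral_Ioc_eq_integral_Ioo, ← intervalIntegral.integral_of_le hab,
    intervalIntegral.integral_eq_sub_of_hasDerivAt_of_le hab hc hd
      ((intervalIntegrable_iff_integrableOn_Ioc_of_le hab).2 hi)]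

/-! ### Filling a spherical zone by great circles: an Abel equation -/

theorem hasDerivAt_sqrt_add_sq {c y : ℝ} (h : 0 < c + y ^ 2) :
    HasDerivAt (fun y => √(c + y ^ 2)) (y / √(c + y ^ 2)) y := by
  have := ((hasDerivAt_pow 2 y).const_add c).sqrt h.ne'
  refine this.congr_deriv ?_
  field_simp
  simp

theorem hasDerivAt_sqrt_sub_sq {c y : ℝ} (h : 0 < c - y ^ 2) :
    HasDerivAt (fun y => √(c - y ^ 2)) (-y / √(c - y ^ 2)) y := by
  have := ((hasDerivAt_pow 2 y).const_sub c).sqrt h.ne'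
  refine this.congr_deriv ?_
  field_simp
  simp

/-- The density, with respect to the area of the disc of radius `τ`, that makes a family of great
circles sweep out the zone `sinh y < τ` of the sphere (in Mercator coordinates) with the weight
prescribed in `lintegral_semicircleKernel`. -/
noncomputable def semicircleKernel (τ C s : ℝ) : ℝ :=
  (√(1 + τ ^ 2) / (1 + s) - C) / √(τ ^ 2 - s)

/-- The numerator decreases in s, and its limit at the rim s = τ² is 1/√(1 + τ²) - C. This is where
the upper bound on C comes from. -/
theorem semicircleKernel_nonneg {τ C s : ℝ} (hC : C ≤ 1 / √(1 + τ ^ 2)) (hs0 : 0 ≤ s)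
    (hs : s < τ ^ 2) : 0 ≤ semicircleKernel τ C s := by
  refine div_nonneg (sub_nonneg.2 (hC.trans ?_)) (Real.sqrt_nonneg _)
  have h1 : 0 < √(1 + τ ^ 2) := by positivity
  rw [div_le_div_iff₀ h1 (by positivity), Real.mul_self_sqrt (by positivity)]
  linarith

/-- This is the Abel equation that the kernel is designed to solve: the chords of the disc must
carry the weight 1/cosh y - C, up to the factor π, at X = sinh y. -/
theorem lintegral_semicircleKernel {τ C X : ℝ} (hC : C ≤ 1 / √(1 + τ ^ 2)) (hX : X ^ 2 < τ ^ 2) :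
    ∫⁻ Y in Ioo (-√(τ ^ 2 - X ^ 2)) (√(τ ^ 2 - X ^ 2)),
      ENNReal.ofReal (semicircleKernel τ C (Y ^ 2 + X ^ 2)) =
    ENNReal.ofReal (Real.pi * (1 / √(1 + X ^ 2) - C)) := by
  set A := √(τ ^ 2 - X ^ 2) with hA
  set E := √(1 + X ^ 2) with hE
  set H := √(1 + τ ^ 2) with hH
  have hA0 : 0 < A := Real.sqrt_pos.2 (by linarith)
  have hE0 : 0 < E := Real.sqrt_pos.2 (by positivity)
  have hH0 : 0 < H := Real.sqrt_pos.2 (by positivity)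
  have hA2 : A ^ 2 = τ ^ 2 - X ^ 2 := Real.sq_sqrt (by linarith)
  have hE2 : E ^ 2 = 1 + X ^ 2 := Real.sq_sqrt (by positivity)
  have hH2 : H ^ 2 = 1 + τ ^ 2 := Real.sq_sqrt (by positivity)
  have hS0 : ∀ Y : ℝ, 0 < √(E ^ 2 + Y ^ 2) := fun Y => Real.sqrt_pos.2 (by positivity)
  -- Both terms of the kernel have arcsine primitives. Each arcsine runs from -π/2 to π/2 along the
  -- chord, which produces π/E - πC.
  have key := lintegral_ofReal_of_hasDerivAt (a := -A) (b := A)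
    (G := fun Y => 1 / E * Real.arcsin (Y * H / (A * √(E ^ 2 + Y ^ 2))) - C * Real.arcsin (Y / A))
    (g := fun Y => semicircleKernel τ C (Y ^ 2 + X ^ 2)) (by linarith) ?_ ?_ ?_
  · rw [key]
    congr 1
    have h1 : √(E ^ 2 + A ^ 2) = H := by rw [hH]; congr 1; rw [hE2, hA2]; ring
    have h2 : A * H / (A * H) = 1 := div_self (by positivity)
    have h3 : -A * H / (A * H) = -1 := by rw [neg_mul, neg_div, h2]
    simp only [neg_sq, h1, h2, h3, div_self hA0.ne', neg_div, Real.arcsin_neg, Real.arcsin_one]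
    ring
  · refine Continuous.continuousOn ?_
    have : ∀ Y : ℝ, A * √(E ^ 2 + Y ^ 2) ≠ 0 := fun Y => (mul_pos hA0 (hS0 Y)).ne'
    have h1 : Continuous fun Y => Y * H / (A * √(E ^ 2 + Y ^ 2)) :=
      Continuous.div (by fun_prop) (by fun_prop) this
    have h2 := Real.continuous_arcsin.comp h1
    have h3 : Continuous fun Y => Real.arcsin (Y / A) :=
      Real.continuous_arcsin.comp (by fun_prop)
    exact (continuous_const.mul h2).sub (continuous_const.mul h3)
  · intro Y hY
    have hYA : Y ^ 2 < A ^ 2 := sq_lt_sq' hY.1 hY.2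
    set S := √(E ^ 2 + Y ^ 2) with hS
    have hSpos : 0 < S := hS0 Y
    have hS2 : S ^ 2 = E ^ 2 + Y ^ 2 := Real.sq_sqrt (by positivity)
    set s := √(A ^ 2 - Y ^ 2) with hs
    have hs0 : 0 < s := Real.sqrt_pos.2 (by linarith)
    have hs2 : s ^ 2 = A ^ 2 - Y ^ 2 := Real.sq_sqrt (by linarith)
    have hq2 : 1 - (Y * H / (A * S)) ^ 2 = (E * s / (A * S)) ^ 2 := by
      field_simp
      rw [hS2, hs2, hH2, hA2, hE2]; ring
    have hq0 : 0 < E * s / (A * S) := by positivity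
    have hr2 : 1 - (Y / A) ^ 2 = (s / A) ^ 2 := by
      field_simp
      rw [hs2]
    have hr0 : 0 < s / A := by positivity
    have dS : HasDerivAt (fun Y => √(E ^ 2 + Y ^ 2)) (Y / S) Y := hasDerivAt_sqrt_add_sq (by positivity)
    have dq : HasDerivAt (fun Y => Y * H / (A * √(E ^ 2 + Y ^ 2))) (H * E ^ 2 / (A * S ^ 3)) Y := by
      have := ((hasDerivAt_id Y).mul_const H).fun_div (dS.const_mul A) (by positivity)
      refine this.congr_deriv ?_
      simp only [id, ← hS]
      field_simp
      rw [hS2]; ring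
    have aux : ∀ q r : ℝ, 0 < r → 1 - q ^ 2 = r ^ 2 → HasDerivAt Real.arcsin (1 / r) q := by
      intro q r hr hqr
      have h := Real.hasDerivAt_arcsin (x := q) (by rintro rfl; nlinarith) (by rintro rfl; nlinarith)
      rwa [hqr, Real.sqrt_sq hr.le] at h
    have d1 := ((aux _ _ hq0 hq2).comp Y dq).const_mul (1 / E)
    have d2 := ((aux _ _ hr0 hr2).comp Y ((hasDerivAt_id Y).div_const A)).const_mul C
    refine (d1.sub d2).congr_deriv ?_
    have e1 : τ ^ 2 - (Y ^ 2 + X ^ 2) = A ^ 2 - Y ^ 2 := by rw [hA2]; ring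
    have e2 : 1 + (Y ^ 2 + X ^ 2) = S ^ 2 := by rw [hS2, hE2]; ring
    rw [semicircleKernel, e1, e2, ← hs, ← hH]
    field_simp
  · intro Y hY
    have hYA : Y ^ 2 < A ^ 2 := sq_lt_sq' hY.1 hY.2
    exact semicircleKernel_nonneg hC (by positivity) (by linarith)

/-- The total weight of the family of great circles. The factor t is the polar Jacobian, and 1/√(1 +
t²) compensates the factor √(1 + t²) in the flat arclength of the circle of slope t. -/
theorem lintegral_semicircleKernel_radial {τ C : ℝ} (hτ : 0 < τ) (hC : C ≤ 1 / √(1 + τ ^ 2)) :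
    ∫⁻ t in Ioo 0 τ, ENNReal.ofReal (t * semicircleKernel τ C (t ^ 2) / √(1 + t ^ 2)) =
    ENNReal.ofReal (τ / √(1 + τ ^ 2) - C * Real.arctan τ) := by
  set H := √(1 + τ ^ 2) with hH
  have hH0 : 0 < H := Real.sqrt_pos.2 (by positivity)
  have hH2 : H ^ 2 = 1 + τ ^ 2 := Real.sq_sqrt (by positivity)
  have hS0 : ∀ t : ℝ, 0 < √(1 + t ^ 2) := fun t => Real.sqrt_pos.2 (by positivity)
  have key := lintegral_ofReal_of_hasDerivAt (a := 0) (b := τ)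
    (G := fun t => -(1 / H) * (√(τ ^ 2 - t ^ 2) / √(1 + t ^ 2)) - C * Real.arcsin (√(1 + t ^ 2) / H))
    (g := fun t => t * semicircleKernel τ C (t ^ 2) / √(1 + t ^ 2)) hτ.le ?_ ?_ ?_
  · rw [key]
    congr 1
    have h1 : Real.arcsin (1 / H) = Real.pi / 2 - Real.arctan τ := by
      rw [Real.arctan_eq_arccos hτ.le, Real.arccos, one_div]; ring
    have h2 : √(τ ^ 2) = τ := Real.sqrt_sq hτ.le
    simp only [sub_self, Real.sqrt_zero, zero_div, mul_zero, ← hH, div_self hH0.ne',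
      Real.arcsin_one, ne_eq, OfNat.ofNat_ne_zero, not_false_eq_true, zero_pow, sub_zero, add_zero,
      Real.sqrt_one, div_one, h1, h2]
    ring
  · refine Continuous.continuousOn ?_
    have h1 : Continuous fun t => √(τ ^ 2 - t ^ 2) / √(1 + t ^ 2) :=
      Continuous.div (by fun_prop) (by fun_prop) fun t => (hS0 t).ne'
    have h3 : Continuous fun t => Real.arcsin (√(1 + t ^ 2) / H) :=
      Real.continuous_arcsin.comp (by fun_prop)
    exact (continuous_const.mul h1).sub (continuous_const.mul h3)
  · intro t ht
    have htτ : t ^ 2 < τ ^ 2 := pow_lt_pow_left₀ ht.2 ht.1.le two_ne_zero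
    set S := √(1 + t ^ 2) with hS
    have hSpos : 0 < S := hS0 t
    have hS2 : S ^ 2 = 1 + t ^ 2 := Real.sq_sqrt (by positivity)
    set s := √(τ ^ 2 - t ^ 2) with hs
    have hs0 : 0 < s := Real.sqrt_pos.2 (by linarith)
    have hs2 : s ^ 2 = τ ^ 2 - t ^ 2 := Real.sq_sqrt (by linarith)
    have dS : HasDerivAt (fun t => √(1 + t ^ 2)) (t / S) t := hasDerivAt_sqrt_add_sq (by positivity)
    have ds : HasDerivAt (fun t => √(τ ^ 2 - t ^ 2)) (-t / s) t := hasDerivAt_sqrt_sub_sq (by linarith)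
    have hq2 : 1 - (S / H) ^ 2 = (s / H) ^ 2 := by
      field_simp
      rw [hS2, hs2, hH2]; ring
    have hq0 : 0 < s / H := by positivity
    have da : HasDerivAt Real.arcsin (1 / (s / H)) (S / H) := by
      have h := Real.hasDerivAt_arcsin (x := S / H)
        (by intro h; rw [h] at hq2; nlinarith) (by intro h; rw [h] at hq2; nlinarith)
      rwa [hq2, Real.sqrt_sq hq0.le] at h
    have d1 := (ds.fun_div dS hSpos.ne').const_mul (-(1 / H))
    have d2 := (da.comp t (dS.div_const H)).const_mul C
    refine (d1.sub d2).congr_deriv ?_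
    rw [semicircleKernel, ← hs, ← hH, ← hS, ← hS2]
    field_simp
    rw [hS2, hs2]
    linear_combination (-t) * hH2
  · intro t ht
    have htτ : t ^ 2 < τ ^ 2 := pow_lt_pow_left₀ ht.2 ht.1.le two_ne_zero
    have := semicircleKernel_nonneg hC (by positivity) htτ
    have := ht.1
    positivity

/-- If a nonnegative function `R` of `X = sinh y` has mean at least `L` (with respect to flat
arclength) over all great circles of slope less than `τ`, then it has the corresponding weighted
mean over the zone `|X| < τ`. -/
theorem mul_le_integral_of_le_greatCircle {τ C L : ℝ} (hτ : 0 < τ) (hC : C ≤ 1 / √(1 + τ ^ 2))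
    (hL0 : 0 ≤ L) {R : ℝ → ℝ} (hR : Continuous R) (hR0 : ∀ x, 0 ≤ R x)
    (hL : ∀ t ∈ Ioo 0 τ, L ≤ ∫ u in (-Real.pi)..Real.pi,
      R (t * Real.sin u) * (√(1 + t ^ 2) / √(1 + (t * Real.sin u) ^ 2))) :
    L * (τ / √(1 + τ ^ 2) - C * Real.arctan τ) ≤
      Real.pi * ∫ X in (-τ)..τ, R X / √(1 + X ^ 2) * (1 / √(1 + X ^ 2) - C) := by
  have hpi := Real.pi_pos
  set G : ℝ × ℝ → ENNReal := fun p => if p.1 ^ 2 + p.2 ^ 2 < τ ^ 2 then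
    ENNReal.ofReal (R p.2 / √(1 + p.2 ^ 2)) *
      ENNReal.ofReal (semicircleKernel τ C (p.1 ^ 2 + p.2 ^ 2)) else 0 with hG
  have hGm : Measurable G := by
    refine Measurable.ite (measurableSet_lt (by fun_prop) (by fun_prop)) ?_ measurable_const
    unfold semicircleKernel
    fun_prop
  -- In polar coordinates (Y, X) = t (cos u, sin u), the circle of radius t parametrizes the great
  -- circle X = t sin u. The kernel is constant on it, so the hypothesis applies circle by circle.
  have hlow : ENNReal.ofReal (L * (τ / √(1 + τ ^ 2) - C * Real.arctan τ)) ≤ ∫⁻ p, G p := by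
    rw [← lintegral_comp_polarCoord_symm, polarCoord_target, Measure.volume_eq_prod,
      ← Measure.prod_restrict, lintegral_prod _ (by
        refine Measurable.aemeasurable ?_
        have := hGm.comp continuous_polarCoord_symm.measurable
        exact (by fun_prop : Measurable fun p : ℝ × ℝ => ENNReal.ofReal p.1).mul this),
      ENNReal.ofReal_mul hL0, ← lintegral_semicircleKernel_radial hτ hC,
      ← lintegral_const_mul' _ _ ENNReal.ofReal_ne_top]
    refine le_trans ?_ (lintegral_mono_set (Ioo_subset_Ioi_self : Ioo 0 τ ⊆ Ioi 0))
    refine setLIntegral_mono' measurableSet_Ioo fun t ht => ?_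
    have htτ : t ^ 2 < τ ^ 2 := pow_lt_pow_left₀ ht.2 ht.1.le two_ne_zero
    have ht0 := ht.1
    have hk := semicircleKernel_nonneg hC (sq_nonneg t) htτ
    have hS : 0 < √(1 + t ^ 2) := by positivity
    have hcont : Continuous fun u => R (t * Real.sin u) / √(1 + (t * Real.sin u) ^ 2) :=
      Continuous.div (by fun_prop) (by fun_prop) fun u => (Real.sqrt_pos.2 (by positivity)).ne'
    have e : ∀ u, ENNReal.ofReal t • G (polarCoord.symm (t, u)) =
        ENNReal.ofReal (t * semicircleKernel τ C (t ^ 2)) *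
          ENNReal.ofReal (R (t * Real.sin u) / √(1 + (t * Real.sin u) ^ 2)) := by
      intro u
      have e1 : (t * Real.cos u) ^ 2 + (t * Real.sin u) ^ 2 = t ^ 2 := by
        rw [mul_pow, mul_pow, ← mul_add, Real.cos_sq_add_sin_sq, mul_one]
      simp only [hG, polarCoord_symm_apply, e1, if_pos htτ, smul_eq_mul]
      rw [ENNReal.ofReal_mul ht0.le]
      ring
    simp only [e]
    rw [lintegral_const_mul' _ _ ENNReal.ofReal_ne_top,
      ← ofReal_integral_eq_lintegral_ofReal
        (hcont.integrableOn_Icc.mono_set Ioo_subset_Icc_self)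
        (Filter.Eventually.of_forall fun u => div_nonneg (hR0 _) (Real.sqrt_nonneg _)),
      ← ENNReal.ofReal_mul hL0, ← ENNReal.ofReal_mul (by positivity),
      ← integral_Ioc_eq_integral_Ioo, ← intervalIntegral.integral_of_le (by linarith)]
    refine ENNReal.ofReal_le_ofReal ?_
    have h := hL t ht
    have e2 : ∫ u in (-Real.pi)..Real.pi,
        R (t * Real.sin u) * (√(1 + t ^ 2) / √(1 + (t * Real.sin u) ^ 2)) =
        √(1 + t ^ 2) * ∫ u in (-Real.pi)..Real.pi,
          R (t * Real.sin u) / √(1 + (t * Real.sin u) ^ 2) := by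
      rw [← intervalIntegral.integral_const_mul]
      congr 1; ext u; ring
    rw [e2, ← div_le_iff₀' hS] at h
    calc L * (t * semicircleKernel τ C (t ^ 2) / √(1 + t ^ 2))
        = t * semicircleKernel τ C (t ^ 2) * (L / √(1 + t ^ 2)) := by ring
      _ ≤ _ := by gcongr
  -- The same integral is now sliced into chords of constant X, on which R is constant and the
  -- kernel contributes its Abel integral.
  have hup : ∫⁻ p, G p = ENNReal.ofReal
      (Real.pi * ∫ X in (-τ)..τ, R X / √(1 + X ^ 2) * (1 / √(1 + X ^ 2) - C)) := by
    have hS : ∀ X : ℝ, √(1 + X ^ 2) ≠ 0 := fun X => (Real.sqrt_pos.2 (by positivity)).ne'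
    have hcont : Continuous fun X => R X / √(1 + X ^ 2) * (Real.pi * (1 / √(1 + X ^ 2) - C)) :=
      (hR.div (by fun_prop) hS).mul
        (continuous_const.mul ((Continuous.div (by fun_prop) (by fun_prop) hS).sub
          continuous_const))
    have hpos : ∀ X ∈ Ioo (-τ) τ, 0 ≤ 1 / √(1 + X ^ 2) - C := by
      intro X hX
      have hXτ : X ^ 2 < τ ^ 2 := sq_lt_sq' hX.1 hX.2
      refine sub_nonneg.2 (hC.trans (one_div_le_one_div_of_le (by positivity) ?_))
      exact Real.sqrt_le_sqrt (by linarith)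
    rw [Measure.volume_eq_prod, lintegral_prod_symm _ hGm.aemeasurable]
    have hinner : ∀ X, ∫⁻ Y, G (Y, X) = (Ioo (-τ) τ).indicator (fun X =>
        ENNReal.ofReal (R X / √(1 + X ^ 2) * (Real.pi * (1 / √(1 + X ^ 2) - C)))) X := by
      intro X
      by_cases hX : X ∈ Ioo (-τ) τ
      · have hXτ : X ^ 2 < τ ^ 2 := sq_lt_sq' hX.1 hX.2
        rw [indicator_of_mem hX, ENNReal.ofReal_mul (div_nonneg (hR0 _) (Real.sqrt_nonneg _)),
          ← lintegral_semicircleKernel hC hXτ, ← lintegral_const_mul' _ _ ENNReal.ofReal_ne_top,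
          ← lintegral_indicator measurableSet_Ioo]
        refine lintegral_congr fun Y => ?_
        have hiff : Y ∈ Ioo (-√(τ ^ 2 - X ^ 2)) (√(τ ^ 2 - X ^ 2)) ↔ Y ^ 2 + X ^ 2 < τ ^ 2 := by
          rw [mem_Ioo, ← abs_lt, Real.lt_sqrt (abs_nonneg _), sq_abs]
          constructor <;> intro h <;> linarith
        by_cases hY : Y ^ 2 + X ^ 2 < τ ^ 2
        · rw [indicator_of_mem (hiff.2 hY)]
          simp only [hG, if_pos hY]
        · rw [indicator_of_notMem (fun h => hY (hiff.1 h))]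
          simp only [hG, if_neg hY]
      · rw [indicator_of_notMem hX]
        refine (lintegral_congr fun Y => ?_).trans lintegral_zero
        have : ¬ (Y ^ 2 + X ^ 2 < τ ^ 2) := fun h => hX (by
          have h2 : X ^ 2 < τ ^ 2 := by nlinarith [sq_nonneg Y]
          exact abs_lt.1 (abs_lt_of_sq_lt_sq h2 hτ.le))
        simp only [hG, if_neg this]
    simp only [hinner]
    rw [lintegral_indicator measurableSet_Ioo, ← ofReal_integral_eq_lintegral_ofReal
        (hcont.integrableOn_Icc.mono_set Ioo_subset_Icc_self)
        ((ae_restrict_iff' measurableSet_Ioo).2 (Filter.Eventually.of_forall fun X hX =>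
          mul_nonneg (div_nonneg (hR0 _) (Real.sqrt_nonneg _)) (mul_nonneg hpi.le (hpos X hX)))),
      ← integral_Ioc_eq_integral_Ioo, ← intervalIntegral.integral_of_le (by linarith),
      ← intervalIntegral.integral_const_mul]
    congr 2; ext X; ring
  rw [hup] at hlow
  refine (ENNReal.ofReal_le_ofReal_iff (mul_nonneg hpi.le ?_)).1 hlow
  refine intervalIntegral.integral_nonneg (by linarith) fun X hX => ?_
  have hXτ : X ^ 2 ≤ τ ^ 2 := sq_le_sq' hX.1 hX.2
  refine mul_nonneg (div_nonneg (hR0 _) (Real.sqrt_nonneg _))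
    (sub_nonneg.2 (hC.trans (one_div_le_one_div_of_le (by positivity) ?_)))
  exact Real.sqrt_le_sqrt (by linarith)

/-! ### Length and volume of a conformal metric through its density -/

theorem continuous_complex_mk : Continuous fun p : ℝ × ℝ => (⟨p.1, p.2⟩ : ℂ) :=
  Complex.equivRealProdCLM.symm.continuous

theorem intervalIntegral_swap_of_continuous {f : ℝ → ℝ → ℝ} (hf : Continuous (Function.uncurry f))
    (a b : ℝ) {c d : ℝ} (hcd : c ≤ d) :
    ∫ x in a..b, ∫ y in c..d, f x y = ∫ y in c..d, ∫ x in a..b, f x y := by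
  simp only [intervalIntegral.integral_of_le hcd]
  refine intervalIntegral_integral_swap ?_
  rw [Measure.prod_restrict]
  exact (hf.continuousOn.integrableOn_compact (isCompact_uIcc.prod isCompact_Icc)).mono_set
    (prod_mono uIoc_subset_uIcc Ioc_subset_Icc_self)

namespace Metric

variable {β : ℝ}

/-- The length of the tangent vector `1`: for a conformal metric `g = ρ² g_β` this is `ρ`. -/
noncomputable def density (g : Metric β) (z : ℂ) : ℝ := √(g.form z 1 1)

theorem density_pos (g : Metric β) (z : ℂ) : 0 < g.density z :=
  Real.sqrt_pos.2 (g.pos z 1 one_ne_zero)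

theorem continuous_density (g : Metric β) : Continuous g.density :=
  (g.continuous 1 1).sqrt

theorem continuous_density_mk (g : Metric β) :
    Continuous (Function.uncurry fun x y : ℝ => g.density ⟨x, y⟩) :=
  g.continuous_density.comp continuous_complex_mk

theorem density_glide (g : Metric β) (x y : ℝ) :
    g.density ⟨x + Real.pi, -y⟩ = g.density ⟨x, y⟩ := by
  have h := g.glide_invariant ⟨x, y⟩ 1 1
  have e : glide ⟨x, y⟩ = ⟨x + Real.pi, -y⟩ := by
    apply Complex.ext <;> simp [glide]
  rw [e, map_one] at h
  rw [density, density, h]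

theorem density_vert (g : Metric β) (x y : ℝ) :
    g.density ⟨x, y + 2 * β⟩ = g.density ⟨x, y⟩ := by
  have h := g.vert_invariant ⟨x, y⟩ 1 1
  have e : vert β ⟨x, y⟩ = ⟨x, y + 2 * β⟩ := by
    apply Complex.ext <;> simp [vert]
  rw [e] at h
  rw [density, density, h]

theorem IsConformal.form_eq {g : Metric β} (hg : g.IsConformal) (z v w : ℂ) :
    g.form z v w = g.density z ^ 2 * (v.re * w.re + v.im * w.im) := by
  obtain ⟨φ, hφ, h⟩ := hg
  have h1 : g.form z 1 1 = φ z := by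
    rw [h]; simp [flat, warped, warpedForm_apply]
  rw [density, h1, Real.sq_sqrt (hφ z).le, h]
  simp [flat, warped, warpedForm_apply]

theorem IsConformal.sqrt_form_self {g : Metric β} (hg : g.IsConformal) (z v : ℂ) :
    √(g.form z v v) = g.density z * ‖v‖ := by
  rw [hg.form_eq, Real.sqrt_mul (by positivity), Real.sqrt_sq (g.density_pos z).le,
    Complex.norm_def, Complex.normSq_apply]

theorem IsConformal.length_eq {g : Metric β} (hg : g.IsConformal) (γ : ℝ → ℂ) :
    g.length γ = ∫ s in (0 : ℝ)..1, g.density (γ s) * ‖deriv γ s‖ := by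
  simp only [length, hg.sqrt_form_self]

theorem IsConformal.vol_eq {g : Metric β} (hg : g.IsConformal) (hβ : 0 < β) :
    g.vol = ∫ y in (0 : ℝ)..(2 * β), ∫ x in (0 : ℝ)..Real.pi, g.density ⟨x, y⟩ ^ 2 := by
  have hpi := Real.pi_pos
  have e : ∀ z, √(g.form z 1 1 * g.form z Complex.I Complex.I - g.form z 1 Complex.I ^ 2) =
      g.density z ^ 2 := by
    intro z
    simp only [hg.form_eq]
    simp only [Complex.one_re, Complex.one_im, Complex.I_re, Complex.I_im]
    refine Eq.trans ?_ (Real.sqrt_sq (sq_nonneg (g.density z)))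
    congr 1; ring
  simp only [vol, e]
  have hc : Continuous (Function.uncurry fun x y : ℝ => g.density ⟨x, y⟩ ^ 2) :=
    g.continuous_density_mk.pow 2
  have h1 := Complex.volume_preserving_equiv_real_prod.setIntegral_preimage_emb
    Complex.measurableEquivRealProd.measurableEmbedding
    (fun p : ℝ × ℝ => g.density ⟨p.1, p.2⟩ ^ 2) (Ico 0 Real.pi ×ˢ Ico 0 (2 * β))
  refine Eq.trans h1 ?_
  rw [Measure.volume_eq_prod, setIntegral_prod]
  · rw [← intervalIntegral_swap_of_continuous hc _ _ (by positivity)]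
    rw [intervalIntegral.integral_of_le hpi.le, integral_Ico_eq_integral_Ioc]
    simp only [intervalIntegral.integral_of_le (show 0 ≤ 2 * β by positivity),
      integral_Ico_eq_integral_Ioc]
  · exact (hc.continuousOn.integrableOn_compact (isCompact_Icc.prod isCompact_Icc)).mono_set
      (prod_mono Ico_subset_Icc_self Ico_subset_Icc_self)

theorem length_nonneg (g : Metric β) (γ : ℝ → ℂ) : 0 ≤ g.length γ :=
  intervalIntegral.integral_nonneg zero_le_one fun _ _ => Real.sqrt_nonneg _

theorem leastLength_nonneg (g : Metric β) (τ : ℂ → ℂ) : 0 ≤ g.leastLength τ := by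
  refine Real.sInf_nonneg ?_
  rintro _ ⟨γ, -, -, rfl⟩
  exact g.length_nonneg γ

theorem leastLength_le (g : Metric β) {τ : ℂ → ℂ} {γ : ℝ → ℂ} {C : NNReal}
    (hγ : LipschitzOnWith C γ (Icc 0 1)) (h : γ 1 = τ (γ 0)) : g.leastLength τ ≤ g.length γ :=
  csInf_le ⟨0, by rintro _ ⟨γ, -, -, rfl⟩; exact g.length_nonneg γ⟩ ⟨γ, ⟨C, hγ⟩, h, rfl⟩

theorem IsConformal.leastLength_le_integral {g : Metric β} (hg : g.IsConformal) {τ : ℂ → ℂ}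
    {z z' : ℝ → ℂ} {c d : ℝ} (hcd : c < d) (hz : ∀ u, HasDerivAt z (z' u) u) (hz' : Continuous z')
    (h : z d = τ (z c)) : g.leastLength τ ≤ ∫ u in c..d, g.density (z u) * ‖z' u‖ := by
  have hd : ∀ s, HasDerivAt (fun s => z ((d - c) * s + c)) ((d - c : ℝ) • z' ((d - c) * s + c)) s := by
    intro s
    have h1 : HasDerivAt (fun s => (d - c) * s + c) (d - c) s := by
      simpa using ((hasDerivAt_id s).const_mul (d - c)).add_const c
    exact (hz _).scomp s h1
  have hC1 : ContDiff ℝ 1 (fun s => z ((d - c) * s + c)) := by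
    rw [contDiff_one_iff_deriv]
    refine ⟨fun s => (hd s).differentiableAt, ?_⟩
    rw [funext fun s => (hd s).deriv]
    fun_prop
  obtain ⟨K, hK⟩ := hC1.locallyLipschitz.locallyLipschitzOn.exists_lipschitzOnWith_of_compact
    (isCompact_Icc (a := (0 : ℝ)) (b := 1))
  refine (g.leastLength_le hK (τ := τ) (by simpa using h)).trans (le_of_eq ?_)
  have hdc : 0 < d - c := sub_pos.2 hcd
  have e := intervalIntegral.mul_integral_comp_mul_add (a := 0) (b := 1)
    (f := fun u => g.density (z u) * ‖z' u‖) (d - c) c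
  rw [mul_zero, zero_add, mul_one, sub_add_cancel] at e
  rw [hg.length_eq, ← e, ← intervalIntegral.integral_const_mul]
  congr 1
  ext s
  rw [(hd s).deriv, norm_smul, Real.norm_of_nonneg hdc.le]
  ring

end Metric

/-! ### Averages of the density and the bounds they give -/

theorem sq_integral_mul_le {f h : ℝ → ℝ} (hf : Continuous f) (hh : Continuous h) {a b : ℝ}
    (hab : a ≤ b) (hpos : 0 < ∫ x in a..b, h x ^ 2) :
    (∫ x in a..b, f x * h x) ^ 2 ≤ (∫ x in a..b, f x ^ 2) * ∫ x in a..b, h x ^ 2 := by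
  have e : ∀ A B : ℝ, ∫ x in a..b, (B * f x - A * h x) ^ 2 =
      B ^ 2 * (∫ x in a..b, f x ^ 2) - 2 * A * B * (∫ x in a..b, f x * h x) +
        A ^ 2 * ∫ x in a..b, h x ^ 2 := by
    intro A B
    have i1 : IntervalIntegrable (fun x => B ^ 2 * f x ^ 2) volume a b :=
      (by fun_prop : Continuous _).intervalIntegrable _ _
    have i2 : IntervalIntegrable (fun x => 2 * A * B * (f x * h x)) volume a b :=
      (by fun_prop : Continuous _).intervalIntegrable _ _
    have i3 : IntervalIntegrable (fun x => A ^ 2 * h x ^ 2) volume a b :=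
      (by fun_prop : Continuous _).intervalIntegrable _ _
    rw [← intervalIntegral.integral_const_mul, ← intervalIntegral.integral_const_mul,
      ← intervalIntegral.integral_const_mul, ← intervalIntegral.integral_sub i1 i2,
      ← intervalIntegral.integral_add (i1.sub i2) i3]
    congr 1; ext x; ring
  -- The square of f minus its projection to h, scaled by ∫ h² to avoid division.
  have h0 : 0 ≤ ∫ x in a..b,
      ((∫ x in a..b, h x ^ 2) * f x - (∫ x in a..b, f x * h x) * h x) ^ 2 :=
    intervalIntegral.integral_nonneg hab fun _ _ => sq_nonneg _
  rw [e] at h0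
  set A := ∫ x in a..b, f x * h x
  set B := ∫ x in a..b, h x ^ 2
  have : 0 ≤ B * ((∫ x in a..b, f x ^ 2) * B - A ^ 2) := by linarith
  linarith [nonneg_of_mul_nonneg_right this hpos]

namespace Metric

variable {β : ℝ}

/-- The `g`-length of the horizontal line at height `y`, of horizontal displacement `2π`. -/
noncomputable def rowLength (g : Metric β) (y : ℝ) : ℝ :=
  ∫ x in (0 : ℝ)..(2 * Real.pi), g.density ⟨x, y⟩

theorem density_periodic (g : Metric β) (y : ℝ) :
    Function.Periodic (fun x => g.density ⟨x, y⟩) (2 * Real.pi) := by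
  intro x
  have h1 := g.density_glide (x + Real.pi) (-y)
  rw [neg_neg, g.density_glide x y] at h1
  simp only
  rw [← h1]
  congr 2; ring

theorem rowLength_eq (g : Metric β) (y c : ℝ) :
    ∫ x in (0 : ℝ)..(2 * Real.pi), g.density ⟨x + c, y⟩ = g.rowLength y := by
  rw [intervalIntegral.integral_comp_add_right (fun x => g.density ⟨x, y⟩) c, zero_add,
    add_comm (2 * Real.pi)]
  have := (g.density_periodic y).intervalIntegral_add_eq c 0
  rwa [zero_add] at this

theorem rowLength_pos (g : Metric β) (y : ℝ) : 0 < g.rowLength y :=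
  intervalIntegral.intervalIntegral_pos_of_pos
    ((g.continuous_density_mk.comp (by fun_prop : Continuous fun x => (x, y))).intervalIntegrable _ _)
    (fun _ => g.density_pos _) (by positivity)

theorem continuous_rowLength (g : Metric β) : Continuous g.rowLength :=
  intervalIntegral.continuous_parametric_intervalIntegral_of_continuous'
    (f := fun y x => g.density ⟨x, y⟩) (g.continuous_density_mk.comp continuous_swap) _ _

theorem rowLength_neg (g : Metric β) (y : ℝ) : g.rowLength (-y) = g.rowLength y := by
  rw [← g.rowLength_eq (-y) Real.pi]
  simp only [g.density_glide, rowLength]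

theorem rowLength_vert (g : Metric β) (y : ℝ) : g.rowLength (y + 2 * β) = g.rowLength y := by
  simp only [rowLength, g.density_vert]

/-- The average of the density over the horizontal lines at heights `y` and `y + β`. -/
noncomputable def profile (g : Metric β) (y : ℝ) : ℝ :=
  (g.rowLength y + g.rowLength (y + β)) / (4 * Real.pi)

theorem continuous_profile (g : Metric β) : Continuous g.profile := by
  have := g.continuous_rowLength
  unfold profile
  fun_prop

theorem profile_pos (g : Metric β) (y : ℝ) : 0 < g.profile y :=
  div_pos (add_pos (g.rowLength_pos _) (g.rowLength_pos _)) (by positivity)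

theorem profile_neg (g : Metric β) (y : ℝ) : g.profile (-y) = g.profile y := by
  have : g.rowLength (-y + β) = g.rowLength (y + β) := by
    rw [← g.rowLength_neg (y + β), ← g.rowLength_vert (-(y + β))]
    congr 1; ring
  rw [profile, profile, g.rowLength_neg, this]

theorem profile_add (g : Metric β) (y : ℝ) : g.profile (y + β) = g.profile y := by
  have : g.rowLength (y + β + β) = g.rowLength y := by
    rw [← g.rowLength_vert y]; congr 1; ring
  rw [profile, profile, this, add_comm]

theorem profile_sub (g : Metric β) (y : ℝ) : g.profile (β - y) = g.profile y := by
  rw [← g.profile_neg y, ← g.profile_add (-y)]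
  congr 1; ring

theorem LSigma_nonneg (g : Metric β) : 0 ≤ g.LSigma :=
  le_min (le_min (g.leastLength_nonneg _) (g.leastLength_nonneg _)) (g.leastLength_nonneg _)

theorem IsConformal.lH_le {g : Metric β} (hg : g.IsConformal) (y : ℝ) : g.lH ≤ g.rowLength y := by
  have hd : ∀ u : ℝ, HasDerivAt (fun u : ℝ => (⟨u, y⟩ : ℂ)) 1 u := by
    intro u
    have : (fun u : ℝ => (⟨u, y⟩ : ℂ)) = fun u : ℝ => (u : ℂ) + (⟨0, y⟩ : ℂ) := by
      funext u; apply Complex.ext <;> simp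
    rw [this]
    simpa using (Complex.ofRealCLM.hasDerivAt (x := u)).add_const (⟨0, y⟩ : ℂ)
  have := hg.leastLength_le_integral (τ := glide ∘ glide) (c := 0) (d := 2 * Real.pi)
    (by positivity) hd continuous_const
    (by apply Complex.ext <;> simp [glide]; ring)
  simpa [lH, rowLength] using this

theorem IsConformal.LSigma_le_profile {g : Metric β} (hg : g.IsConformal) (y : ℝ) :
    g.LSigma ≤ 2 * Real.pi * g.profile y := by
  have h1 : g.LSigma ≤ g.lH := min_le_right _ _
  have h2 := hg.lH_le y
  have h3 := hg.lH_le (y + β)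
  have : 2 * Real.pi * g.profile y = (g.rowLength y + g.rowLength (y + β)) / 2 := by
    rw [profile]; field_simp; ring
  linarith

/-- Fubini over all horizontal translates of one curve: averaging a lower bound valid for each
translate replaces the density by row lengths. The number e is the horizontal speed, 0 for vertical
lines and 1 for graphs over the horizontal axis. -/
theorem mul_le_integral_rowLength {g : Metric β} {L c d : ℝ} {Y w : ℝ → ℝ} (hcd : c ≤ d)
    (hY : Continuous Y) (hw : Continuous w) (e : ℝ)
    (h : ∀ x, L ≤ ∫ u in c..d, g.density ⟨x + e * u, Y u⟩ * w u) :
    2 * Real.pi * L ≤ ∫ u in c..d, g.rowLength (Y u) * w u := by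
  have hc : Continuous (Function.uncurry fun x u => g.density ⟨x + e * u, Y u⟩ * w u) := by
    have : Continuous fun p : ℝ × ℝ => (p.1 + e * p.2, Y p.2) := by fun_prop
    exact (g.continuous_density_mk.comp this).mul (by fun_prop)
  have h1 : ∫ x in (0 : ℝ)..(2 * Real.pi), L ≤
      ∫ x in (0 : ℝ)..(2 * Real.pi), ∫ u in c..d, g.density ⟨x + e * u, Y u⟩ * w u := by
    refine intervalIntegral.integral_mono_on (by positivity) (by simp) ?_ fun x _ => h x
    exact (intervalIntegral.continuous_parametric_intervalIntegral_of_continuous'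
      hc _ _).intervalIntegrable _ _
  rw [intervalIntegral_swap_of_continuous hc _ _ hcd] at h1
  simpa only [intervalIntegral.integral_mul_const, rowLength_eq,
    intervalIntegral.integral_const, sub_zero, smul_eq_mul] using h1

theorem IsConformal.lV_le {g : Metric β} (hg : g.IsConformal) (hβ : 0 < β) :
    2 * Real.pi * g.lV ≤ ∫ y in (0 : ℝ)..(2 * β), g.rowLength y := by
  have hd : ∀ x u : ℝ, HasDerivAt (fun u : ℝ => (⟨x, u⟩ : ℂ)) Complex.I u := by
    intro x u
    have : (fun u : ℝ => (⟨x, u⟩ : ℂ)) = fun u : ℝ => (u : ℂ) * Complex.I + (x : ℂ) := by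
      funext u; apply Complex.ext <;> simp
    rw [this]
    simpa using ((Complex.ofRealCLM.hasDerivAt (x := u)).mul_const Complex.I).add_const (x : ℂ)
  have := mul_le_integral_rowLength (g := g) (L := g.lV) (c := 0) (d := 2 * β) (Y := fun y => y)
    (w := fun _ => 1) (by positivity) continuous_id continuous_const 0 (fun x => by
      have := hg.leastLength_le_integral (τ := vert β) (c := 0) (d := 2 * β) (by positivity) (hd x)
        continuous_const (by apply Complex.ext <;> simp [vert])
      simpa [lV] using this)
  simpa using this

/-- The great semicircle `sinh y = t sin u`, raised by `y₀`. -/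
theorem IsConformal.leastLength_le_semicircle {g : Metric β} (hg : g.IsConformal) {τ : ℂ → ℂ}
    (y₀ : ℝ) (hτ : ∀ x y, τ ⟨x, y₀ + y⟩ = ⟨x + Real.pi, y₀ - y⟩) (t c : ℝ) :
    2 * Real.pi * g.leastLength τ ≤ ∫ u in c..(c + Real.pi),
      g.rowLength (y₀ + Real.arsinh (t * Real.sin u)) *
        (√(1 + t ^ 2) / √(1 + (t * Real.sin u) ^ 2)) := by
  have hpi := Real.pi_pos
  have hS : ∀ u, 0 < √(1 + (t * Real.sin u) ^ 2) := fun u => Real.sqrt_pos.2 (by positivity)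
  have hY : ∀ u, HasDerivAt (fun u => y₀ + Real.arsinh (t * Real.sin u))
      (t * Real.cos u / √(1 + (t * Real.sin u) ^ 2)) u := by
    intro u
    have := (((Real.hasDerivAt_sin u).const_mul t).arsinh).const_add y₀
    refine this.congr_deriv ?_
    rw [smul_eq_mul]; ring
  have hcont : Continuous fun u => t * Real.cos u / √(1 + (t * Real.sin u) ^ 2) :=
    Continuous.div (by fun_prop) (by fun_prop) fun u => (hS u).ne'
  refine mul_le_integral_rowLength (by linarith) ?_ ?_ 1 fun x => ?_
  · exact continuous_iff_continuousAt.2 fun u => (hY u).continuousAt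
  · exact Continuous.div (by fun_prop) (by fun_prop) fun u => (hS u).ne'
  have hd : ∀ u : ℝ, HasDerivAt (fun u : ℝ => (⟨x + 1 * u, y₀ + Real.arsinh (t * Real.sin u)⟩ : ℂ))
      (1 + (t * Real.cos u / √(1 + (t * Real.sin u) ^ 2) : ℝ) * Complex.I) u := by
    intro u
    have : (fun u : ℝ => (⟨x + 1 * u, y₀ + Real.arsinh (t * Real.sin u)⟩ : ℂ)) = fun u : ℝ =>
        (u : ℂ) + ((y₀ + Real.arsinh (t * Real.sin u) : ℝ) : ℂ) * Complex.I + (x : ℂ) := by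
      funext u; apply Complex.ext <;> simp [add_comm]
    rw [this]
    exact ((Complex.ofRealCLM.hasDerivAt (x := u)).add
      ((hY u).ofReal_comp.mul_const Complex.I)).add_const (x : ℂ)
  have h := hg.leastLength_le_integral (τ := τ) (c := c) (d := c + Real.pi) (by linarith) hd
    (by fun_prop) (by
      rw [hτ]
      apply Complex.ext <;> simp [Real.sin_add_pi] <;> ring)
  refine h.trans (le_of_eq ?_)
  congr 1; ext u
  congr 1
  -- The squared flat speed is 1 + t² cos² u / (1 + t² sin² u) = (1 + t²)/(1 + t² sin² u).
  rw [Complex.norm_def, Complex.normSq_apply, ← Real.sqrt_div (by positivity)]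
  congr 1
  have h2 : √(1 + (t * Real.sin u) ^ 2) ^ 2 = 1 + (t * Real.sin u) ^ 2 :=
    Real.sq_sqrt (by positivity)
  simp only [Complex.add_re, Complex.one_re, Complex.re_ofReal_mul, Complex.I_re, mul_zero,
    add_zero, Complex.add_im, Complex.one_im, Complex.im_ofReal_mul, Complex.I_im, mul_one, zero_add]
  rw [div_mul_div_comm, ← sq √_, h2, eq_div_iff (by positivity), add_mul,
    div_mul_cancel₀ _ (by positivity)]
  linear_combination t ^ 2 * Real.sin_sq_add_cos_sq u

/-- Semicircles about the axis y = 0 close up under σ, and those about y = β under tσ. Averaging the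
two bounds turns row lengths into `profile`. -/
theorem IsConformal.LSigma_le_semicircle {g : Metric β} (hg : g.IsConformal) (t c : ℝ) :
    g.LSigma ≤ ∫ u in c..(c + Real.pi), g.profile (Real.arsinh (t * Real.sin u)) *
        (√(1 + t ^ 2) / √(1 + (t * Real.sin u) ^ 2)) := by
  have h1 := hg.leastLength_le_semicircle (τ := glide) 0
    (fun x y => by apply Complex.ext <;> simp [glide]) t c
  have h2 := hg.leastLength_le_semicircle (τ := vert β ∘ glide) β
    (fun x y => by apply Complex.ext <;> simp [glide, vert]; ring) t c
  have h3 : g.LSigma ≤ g.leastLength glide := (min_le_left _ _).trans (min_le_left _ _)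
  have h4 : g.LSigma ≤ g.leastLength (vert β ∘ glide) := (min_le_left _ _).trans (min_le_right _ _)
  have hw : Continuous fun u => √(1 + t ^ 2) / √(1 + (t * Real.sin u) ^ 2) :=
    Continuous.div (by fun_prop) (by fun_prop) fun u => (Real.sqrt_pos.2 (by positivity)).ne'
  have hc : Continuous fun u => Real.arsinh (t * Real.sin u) :=
    Real.continuous_arsinh.comp (by fun_prop)
  have hr := g.continuous_rowLength
  have e : ∫ u in c..(c + Real.pi), g.profile (Real.arsinh (t * Real.sin u)) *
        (√(1 + t ^ 2) / √(1 + (t * Real.sin u) ^ 2)) = 1 / (4 * Real.pi) *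
      ((∫ u in c..(c + Real.pi), g.rowLength (0 + Real.arsinh (t * Real.sin u)) *
        (√(1 + t ^ 2) / √(1 + (t * Real.sin u) ^ 2))) +
      ∫ u in c..(c + Real.pi), g.rowLength (β + Real.arsinh (t * Real.sin u)) *
        (√(1 + t ^ 2) / √(1 + (t * Real.sin u) ^ 2))) := by
    rw [← intervalIntegral.integral_add, ← intervalIntegral.integral_const_mul]
    · congr 1; ext u
      rw [profile, zero_add, add_comm β]
      ring
    · exact ((hr.comp (continuous_const.add hc)).mul hw).intervalIntegrable _ _
    · exact ((hr.comp (continuous_const.add hc)).mul hw).intervalIntegrable _ _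
  rw [e]
  have hpi := Real.pi_pos
  calc g.LSigma = 1 / (4 * Real.pi) * (2 * Real.pi * g.LSigma + 2 * Real.pi * g.LSigma) := by
        field_simp; ring
    _ ≤ 1 / (4 * Real.pi) * (2 * Real.pi * g.leastLength glide +
          2 * Real.pi * g.leastLength (vert β ∘ glide)) := by gcongr
    _ ≤ _ := by gcongr

theorem integral_half_of_symm {m : ℝ → ℝ} (hm : Continuous m) (hs : ∀ y, m (β - y) = m y) :
    ∫ y in (0 : ℝ)..β, m y = 2 * ∫ y in (0 : ℝ)..(β / 2), m y := by
  have h := intervalIntegral.integral_comp_sub_left (a := 0) (b := β / 2) m β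
  simp only [hs, sub_zero] at h
  rw [show β - β / 2 = β / 2 by ring] at h
  rw [← intervalIntegral.integral_add_adjacent_intervals (hm.intervalIntegrable 0 (β / 2))
    (hm.intervalIntegrable _ _), ← h]
  ring

theorem integral_two_mul {f : ℝ → ℝ} (hf : Continuous f) :
    ∫ y in (0 : ℝ)..(2 * β), f y = ∫ y in (0 : ℝ)..β, (f y + f (y + β)) := by
  have h := intervalIntegral.integral_comp_add_right (a := 0) (b := β) f β
  rw [zero_add, ← two_mul] at h
  rw [intervalIntegral.integral_add (hf.intervalIntegrable _ _)
    ((by fun_prop : Continuous fun y => f (y + β)).intervalIntegrable _ _), h,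
    intervalIntegral.integral_add_adjacent_intervals (hf.intervalIntegrable _ _)
    (hf.intervalIntegrable _ _)]

theorem IsConformal.lV_le_profile {g : Metric β} (hg : g.IsConformal) (hβ : 0 < β) :
    g.lV ≤ 4 * ∫ y in (0 : ℝ)..(β / 2), g.profile y := by
  have h := hg.lV_le hβ
  have hpi := Real.pi_pos
  have e : ∀ y, g.rowLength y + g.rowLength (y + β) = 4 * Real.pi * g.profile y := by
    intro y; rw [profile]; field_simp
  rw [integral_two_mul g.continuous_rowLength] at h
  simp only [e] at h
  rw [intervalIntegral.integral_const_mul,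
    integral_half_of_symm g.continuous_profile g.profile_sub] at h
  refine le_of_mul_le_mul_left (h.trans (le_of_eq ?_)) (by positivity : 0 < 2 * Real.pi)
  ring

/-- The rectangle is a fundamental domain of the double cover by a torus, and σ exchanges its left
and right halves up to a vertical period. -/
theorem IsConformal.vol_eq_half {g : Metric β} (hg : g.IsConformal) (hβ : 0 < β) :
    2 * g.vol = ∫ y in (0 : ℝ)..(2 * β), ∫ x in (0 : ℝ)..(2 * Real.pi), g.density ⟨x, y⟩ ^ 2 := by
  have hc : Continuous fun p : ℝ × ℝ => g.density ⟨p.1, p.2⟩ ^ 2 := g.continuous_density_mk.pow 2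
  set S : ℝ → ℝ := fun y => ∫ x in (0 : ℝ)..Real.pi, g.density ⟨x, y⟩ ^ 2 with hS
  have hSc : Continuous S :=
    intervalIntegral.continuous_parametric_intervalIntegral_of_continuous'
      (f := fun y x => g.density ⟨x, y⟩ ^ 2) (hc.comp continuous_swap) _ _
  have hSp : Function.Periodic S (2 * β) := fun y => by simp only [hS, g.density_vert]
  have e : ∀ y, ∫ x in (0 : ℝ)..(2 * Real.pi), g.density ⟨x, y⟩ ^ 2 = S y + S (-y) := by
    intro y
    have hi : Continuous fun x => g.density ⟨x, y⟩ ^ 2 :=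
      hc.comp (by fun_prop : Continuous fun x => (x, y))
    rw [← intervalIntegral.integral_add_adjacent_intervals (hi.intervalIntegrable 0 Real.pi)
      (hi.intervalIntegrable _ _)]
    congr 1
    have h := intervalIntegral.integral_comp_add_right (a := 0) (b := Real.pi)
      (fun x => g.density ⟨x, y⟩ ^ 2) Real.pi
    rw [zero_add, ← two_mul] at h
    rw [← h]
    simp only [hS]
    congr 1; ext x
    rw [← g.density_glide x (-y), neg_neg]
  simp only [e]
  rw [intervalIntegral.integral_add (hSc.intervalIntegrable _ _)
    ((by fun_prop : Continuous fun y => S (-y)).intervalIntegrable _ _), intervalIntegral.integral_comp_neg, neg_zero,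
    hg.vol_eq hβ]
  have h := hSp.intervalIntegral_add_eq (-(2 * β)) 0
  rw [neg_add_cancel, zero_add] at h
  rw [h]; ring

theorem sq_rowLength_le (g : Metric β) (y : ℝ) :
    g.rowLength y ^ 2 ≤ 2 * Real.pi * ∫ x in (0 : ℝ)..(2 * Real.pi), g.density ⟨x, y⟩ ^ 2 := by
  have hpi := Real.pi_pos
  have hi : Continuous fun x => g.density ⟨x, y⟩ :=
    g.continuous_density_mk.comp (by fun_prop : Continuous fun x => (x, y))
  have := sq_integral_mul_le hi (continuous_const (y := (1 : ℝ))) (a := 0) (b := 2 * Real.pi)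
    (by positivity) (by simp; positivity)
  simp only [mul_one, one_pow, intervalIntegral.integral_const, sub_zero, smul_eq_mul] at this
  rw [rowLength]
  linarith

/-- Cauchy–Schwarz is applied on each horizontal line, then convexity of the square to the pair of
lines at y and y + β. -/
theorem IsConformal.profile_sq_le_vol {g : Metric β} (hg : g.IsConformal) (hβ : 0 < β) :
    4 * Real.pi * ∫ y in (0 : ℝ)..(β / 2), g.profile y ^ 2 ≤ g.vol := by
  have hpi := Real.pi_pos
  have hr := g.continuous_rowLength
  have hc : Continuous fun p : ℝ × ℝ => g.density ⟨p.1, p.2⟩ ^ 2 := g.continuous_density_mk.pow 2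
  have hq : Continuous fun y => ∫ x in (0 : ℝ)..(2 * Real.pi), g.density ⟨x, y⟩ ^ 2 :=
    intervalIntegral.continuous_parametric_intervalIntegral_of_continuous'
      (f := fun y x => g.density ⟨x, y⟩ ^ 2) (hc.comp continuous_swap) _ _
  have hm := g.continuous_profile
  have h1 : ∫ y in (0 : ℝ)..(2 * β), g.rowLength y ^ 2 ≤ 2 * Real.pi * (2 * g.vol) := by
    rw [hg.vol_eq_half hβ, ← intervalIntegral.integral_const_mul]
    exact intervalIntegral.integral_mono_on (by positivity) ((hr.pow 2).intervalIntegrable _ _)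
      ((continuous_const.mul hq).intervalIntegrable _ _) fun y _ => g.sq_rowLength_le y
  rw [integral_two_mul (f := fun y => g.rowLength y ^ 2) (hr.pow 2)] at h1
  have h2 : ∫ y in (0 : ℝ)..β, 8 * Real.pi ^ 2 * g.profile y ^ 2 ≤
      ∫ y in (0 : ℝ)..β, (g.rowLength y ^ 2 + g.rowLength (y + β) ^ 2) := by
    refine intervalIntegral.integral_mono_on hβ.le
      ((by fun_prop : Continuous _).intervalIntegrable _ _)
      ((by fun_prop : Continuous _).intervalIntegrable _ _) fun y _ => ?_
    have : 8 * Real.pi ^ 2 * g.profile y ^ 2 = (g.rowLength y + g.rowLength (y + β)) ^ 2 / 2 := by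
      rw [profile]; field_simp; ring
    rw [this]
    nlinarith [sq_nonneg (g.rowLength y - g.rowLength (y + β))]
  rw [intervalIntegral.integral_const_mul, integral_half_of_symm (m := fun y => g.profile y ^ 2) (hm.pow 2)
    (fun y => by simp only [g.profile_sub])] at h2
  have h3 := h2.trans h1
  refine le_of_mul_le_mul_left (a := 4 * Real.pi) ?_ (by positivity)
  linarith

end Metric

/-! ### The extremal profile and its integrals -/

theorem sqrt_one_add_sinh_sq (y : ℝ) : √(1 + Real.sinh y ^ 2) = Real.cosh y := by
  rw [← Real.cosh_sq', Real.sqrt_sq (Real.cosh_pos y).le]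

/-- The profile, as a function of the conformal height `y ∈ [0, β/2]`, of the extremal metrics. -/
noncomputable def capProfile (a y : ℝ) : ℝ := 1 / Real.cosh (min y a)

theorem continuous_capProfile (a : ℝ) : Continuous (capProfile a) :=
  Continuous.div continuous_const (Real.continuous_cosh.comp (by fun_prop))
    fun _ => (Real.cosh_pos _).ne'

theorem capProfile_pos (a y : ℝ) : 0 < capProfile a y := by
  have := Real.cosh_pos (min y a)
  unfold capProfile; positivity

theorem hasDerivAt_arctan_sinh (y : ℝ) :
    HasDerivAt (fun y => Real.arctan (Real.sinh y)) (1 / Real.cosh y) y := by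
  refine (Real.hasDerivAt_sinh y).arctan.congr_deriv ?_
  rw [← Real.cosh_sq']
  field_simp [(Real.cosh_pos y).ne']

theorem hasDerivAt_tanh (y : ℝ) :
    HasDerivAt (fun y => Real.sinh y / Real.cosh y) ((1 / Real.cosh y) ^ 2) y := by
  have h := (Real.cosh_pos y).ne'
  refine ((Real.hasDerivAt_sinh y).div (Real.hasDerivAt_cosh y) h).congr_deriv ?_
  field_simp
  linarith [Real.cosh_sq' y]

theorem continuous_one_div_cosh : Continuous fun y => 1 / Real.cosh y :=
  continuous_const.div Real.continuous_cosh fun _ => (Real.cosh_pos _).ne'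

theorem integral_one_div_cosh (a b : ℝ) :
    ∫ y in a..b, 1 / Real.cosh y = Real.arctan (Real.sinh b) - Real.arctan (Real.sinh a) :=
  intervalIntegral.integral_eq_sub_of_hasDerivAt (fun y _ => hasDerivAt_arctan_sinh y)
    (continuous_one_div_cosh.intervalIntegrable _ _)

theorem integral_one_div_cosh_sq (a b : ℝ) :
    ∫ y in a..b, (1 / Real.cosh y) ^ 2 = Real.sinh b / Real.cosh b - Real.sinh a / Real.cosh a :=
  intervalIntegral.integral_eq_sub_of_hasDerivAt (fun y _ => hasDerivAt_tanh y)
    ((continuous_one_div_cosh.pow 2).intervalIntegrable _ _)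

theorem integral_comp_capProfile {F : ℝ → ℝ → ℝ} (hF : Continuous (Function.uncurry F)) {a c : ℝ}
    (h0 : 0 ≤ a) (hac : a ≤ c) :
    ∫ y in (0 : ℝ)..c, F y (capProfile a y) =
      (∫ y in (0 : ℝ)..a, F y (1 / Real.cosh y)) + ∫ y in a..c, F y (1 / Real.cosh a) := by
  have hc : Continuous fun y => F y (capProfile a y) :=
    hF.comp (continuous_id.prodMk (continuous_capProfile a))
  rw [← intervalIntegral.integral_add_adjacent_intervals (hc.intervalIntegrable 0 a)
    (hc.intervalIntegrable a c)]
  congr 1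
  · refine intervalIntegral.integral_congr fun y hy => ?_
    rw [uIcc_of_le h0] at hy
    simp only [capProfile, min_eq_left hy.2]
  · refine intervalIntegral.integral_congr fun y hy => ?_
    rw [uIcc_of_le hac] at hy
    simp only [capProfile, min_eq_right hy.1]

theorem integral_capProfile {a c : ℝ} (h0 : 0 ≤ a) (hac : a ≤ c) :
    ∫ y in (0 : ℝ)..c, capProfile a y = Real.arctan (Real.sinh a) + (c - a) / Real.cosh a := by
  rw [integral_comp_capProfile (F := fun _ p => p) continuous_snd h0 hac, integral_one_div_cosh]
  simp [div_eq_mul_inv]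

theorem integral_capProfile_sq {a c : ℝ} (h0 : 0 ≤ a) (hac : a ≤ c) :
    ∫ y in (0 : ℝ)..c, capProfile a y ^ 2 =
      Real.sinh a / Real.cosh a + (c - a) / Real.cosh a ^ 2 := by
  rw [integral_comp_capProfile (F := fun _ p => p ^ 2) (continuous_snd.pow 2) h0 hac,
    integral_one_div_cosh_sq]
  simp [div_eq_mul_inv]

theorem integral_even {f : ℝ → ℝ} (hf : Continuous f) (he : ∀ y, f (-y) = f y) (a : ℝ) :
    ∫ y in (-a)..a, f y = 2 * ∫ y in (0 : ℝ)..a, f y := by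
  have h := intervalIntegral.integral_comp_neg (a := 0) (b := a) f
  simp only [he, neg_zero] at h
  rw [← intervalIntegral.integral_add_adjacent_intervals (hf.intervalIntegrable (-a) 0)
    (hf.intervalIntegrable _ _), ← h]
  ring

/-! ### The isosystolic inequality -/

namespace Metric

variable {β : ℝ}

/-- The great circle average at τ = sinh a, after the substitution X = sinh y. The lower bound along
a whole great circle is twice L_σ, since its two halves are both admissible. -/
theorem IsConformal.LSigma_mul_le_cap {g : Metric β} (hg : g.IsConformal) {a C : ℝ} (ha : 0 < a)
    (hC : C ≤ 1 / Real.cosh a) :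
    g.LSigma * (Real.sinh a / Real.cosh a - C * Real.arctan (Real.sinh a)) ≤
      Real.pi * ∫ y in (0 : ℝ)..a, g.profile y * (1 / Real.cosh y - C) := by
  have hm := g.continuous_profile
  have hmR : Continuous fun X => g.profile (Real.arsinh X) := hm.comp Real.continuous_arsinh
  have hS : ∀ X : ℝ, √(1 + X ^ 2) ≠ 0 := fun X => (Real.sqrt_pos.2 (by positivity)).ne'
  have key := mul_le_integral_of_le_greatCircle (τ := Real.sinh a) (C := C) (L := 2 * g.LSigma)
    (R := fun X => g.profile (Real.arsinh X)) (Real.sinh_pos_iff.2 ha)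
    (by rwa [sqrt_one_add_sinh_sq]) (mul_nonneg zero_le_two g.LSigma_nonneg)
    hmR (fun X => (g.profile_pos _).le) (by
      intro t _
      have h1 := hg.LSigma_le_semicircle t (-Real.pi)
      have h2 := hg.LSigma_le_semicircle t 0
      rw [neg_add_cancel] at h1
      rw [zero_add] at h2
      have hi : Continuous fun u => g.profile (Real.arsinh (t * Real.sin u)) *
          (√(1 + t ^ 2) / √(1 + (t * Real.sin u) ^ 2)) :=
        (hmR.comp (by fun_prop : Continuous fun u => t * Real.sin u)).mul
          (Continuous.div (by fun_prop) (by fun_prop) fun u => hS _)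
      rw [← intervalIntegral.integral_add_adjacent_intervals (hi.intervalIntegrable _ 0)
        (hi.intervalIntegrable _ _)]
      linarith)
  have hsub := intervalIntegral.integral_comp_mul_deriv (a := -a) (b := a) (f := Real.sinh)
    (f' := Real.cosh) (g := fun X => g.profile (Real.arsinh X) / √(1 + X ^ 2) *
      (1 / √(1 + X ^ 2) - C)) (fun y _ => Real.hasDerivAt_sinh y)
    Real.continuous_cosh.continuousOn
    ((hmR.div (by fun_prop) hS).mul ((continuous_const.div (by fun_prop) hS).sub continuous_const))
  rw [sqrt_one_add_sinh_sq, ← Real.sinh_neg, ← hsub] at key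
  have e : ∀ y, ((fun X => g.profile (Real.arsinh X) / √(1 + X ^ 2) *
      (1 / √(1 + X ^ 2) - C)) ∘ Real.sinh) y * Real.cosh y =
      g.profile y * (1 / Real.cosh y - C) := by
    intro y
    simp only [Function.comp, sqrt_one_add_sinh_sq, Real.arsinh_sinh]
    field_simp [(Real.cosh_pos y).ne']
  simp only [e] at key
  rw [integral_even (f := fun y => g.profile y * (1 / Real.cosh y - C))
    (hm.mul (continuous_one_div_cosh.sub continuous_const))
    (fun y => by simp only [g.profile_neg, Real.cosh_neg])] at key
  linarith

/-- The isosystolic inequality, with the constant expressed through the cap radius `a`. -/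
theorem IsConformal.LSigma_mul_lV_le {g : Metric β} (hg : g.IsConformal) {a : ℝ} (ha : 0 < a)
    (haβ : a ≤ β / 2) (hcosh : Real.cosh a ≤ 2) (h : a = β / 2 ∨ Real.cosh a = 2) :
    g.LSigma * g.lV * (∫ y in (0 : ℝ)..(β / 2), capProfile a y ^ 2) ≤
      (∫ y in (0 : ℝ)..(β / 2), capProfile a y) * g.vol := by
  have hβ : 0 < β := by linarith
  have hpi := Real.pi_pos
  have hm := g.continuous_profile
  have hp := continuous_capProfile a
  have hH := Real.cosh_pos a
  set L := g.LSigma with hL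
  set l := g.lV with hl
  have hL0 : 0 ≤ L := g.LSigma_nonneg
  have hl0 : 0 ≤ l := g.leastLength_nonneg _
  set I := ∫ y in (0 : ℝ)..(β / 2), capProfile a y ^ 2 with hI
  set b := ∫ y in (0 : ℝ)..(β / 2), capProfile a y with hb
  have hI' : I = _ := integral_capProfile_sq ha.le haβ
  have hb' : b = _ := integral_capProfile ha.le haβ
  have hI0 : 0 < I := intervalIntegral.intervalIntegral_pos_of_pos
    ((hp.pow 2).intervalIntegrable _ _) (fun y => pow_pos (capProfile_pos a y) 2) (by linarith)
  have hb0 : 0 < b := intervalIntegral.intervalIntegral_pos_of_pos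
    (hp.intervalIntegrable _ _) (capProfile_pos a) (by linarith)
  -- This choice gives C b = I - C b = I/2, so L and l enter with the weights for which the final
  -- mean inequality is an equality at L = π, l = 4b.
  set C := I / (2 * b) with hC
  have hC0 : 0 ≤ C := by positivity
  -- From tanh a = sin(arctan(sinh a)) ≤ arctan(sinh a) and cosh a ≤ 2, the cap part of I is at most
  -- that of 2b/cosh a. The band part occurs once in I and twice in 2b/cosh a.
  have hCH : C ≤ 1 / Real.cosh a := by
    have h1 : Real.sinh a / Real.cosh a ≤ Real.arctan (Real.sinh a) := by
      have h2 := Real.sin_le (Real.arctan_nonneg.2 (Real.sinh_pos_iff.2 ha).le)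
      rwa [Real.sin_arctan, sqrt_one_add_sinh_sq] at h2
    have h0 : 0 ≤ Real.arctan (Real.sinh a) := Real.arctan_nonneg.2 (Real.sinh_pos_iff.2 ha).le
    have h3 : Real.arctan (Real.sinh a) ≤ 2 * Real.arctan (Real.sinh a) / Real.cosh a := by
      rw [le_div_iff₀ hH]; nlinarith
    have h4 : 0 ≤ (β / 2 - a) / Real.cosh a ^ 2 := div_nonneg (by linarith) (by positivity)
    have h5 : 1 / Real.cosh a * (2 * b) = 2 * Real.arctan (Real.sinh a) / Real.cosh a +
        2 * ((β / 2 - a) / Real.cosh a ^ 2) := by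
      rw [hb']; field_simp
    rw [hC, div_le_iff₀ (by positivity), h5, hI']
    linarith
  have hcap := hg.LSigma_mul_le_cap ha hCH
  -- Either the band a ≤ y ≤ β/2 is degenerate, or p = 1/2 there and the parallels give m ≥ L/(2π),
  -- with equality for m = p and L = π.
  have hband : L / Real.pi * ((β / 2 - a) / Real.cosh a * (1 / Real.cosh a - C)) ≤
      ∫ y in a..(β / 2), g.profile y * (1 / Real.cosh a - C) := by
    rcases h with h | h
    · simp [h]
    · rw [intervalIntegral.integral_mul_const, h]
      have h1 : ∫ _ in a..(β / 2), L / (2 * Real.pi) ≤ ∫ y in a..(β / 2), g.profile y := by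
        refine intervalIntegral.integral_mono_on haβ (by simp) (hm.intervalIntegrable _ _)
          fun y _ => ?_
        rw [div_le_iff₀ (by positivity), mul_comm]
        exact hg.LSigma_le_profile y
      rw [intervalIntegral.integral_const, smul_eq_mul] at h1
      rw [h] at hCH
      calc L / Real.pi * ((β / 2 - a) / 2 * (1 / 2 - C))
          = (β / 2 - a) * (L / (2 * Real.pi)) * (1 / 2 - C) := by field_simp
        _ ≤ _ := mul_le_mul_of_nonneg_right h1 (by linarith)
  have hsplit := integral_comp_capProfile (F := fun y p => g.profile y * (p - C))
    (by fun_prop) ha.le haβ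
  have hvert := hg.lV_le_profile hβ
  have hdec : ∫ y in (0 : ℝ)..(β / 2), g.profile y * capProfile a y =
      (∫ y in (0 : ℝ)..(β / 2), g.profile y * (capProfile a y - C)) +
        C * ∫ y in (0 : ℝ)..(β / 2), g.profile y := by
    rw [← intervalIntegral.integral_const_mul, ← intervalIntegral.integral_add
      ((by fun_prop : Continuous _).intervalIntegrable _ _)
      ((by fun_prop : Continuous _).intervalIntegrable _ _)]
    congr 1; ext y; ring
  have hcap' : L / Real.pi * (Real.sinh a / Real.cosh a - C * Real.arctan (Real.sinh a)) ≤
      ∫ y in (0 : ℝ)..a, g.profile y * (1 / Real.cosh y - C) := by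
    rw [div_mul_eq_mul_div, div_le_iff₀ hpi]; linarith
  have hsum : L / Real.pi * (I - C * b) + C * (l / 4) ≤
      ∫ y in (0 : ℝ)..(β / 2), g.profile y * capProfile a y := by
    rw [hdec, hsplit]
    have e : L / Real.pi * (I - C * b) =
        L / Real.pi * (Real.sinh a / Real.cosh a - C * Real.arctan (Real.sinh a)) +
        L / Real.pi * ((β / 2 - a) / Real.cosh a * (1 / Real.cosh a - C)) := by
      rw [hI', hb']; field_simp; ring
    have h6 : C * (l / 4) ≤ C * ∫ y in (0 : ℝ)..(β / 2), g.profile y :=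
      mul_le_mul_of_nonneg_left (by linarith) hC0
    rw [e]
    linarith
  have hcs := sq_integral_mul_le hm hp (show (0 : ℝ) ≤ β / 2 by linarith) hI0
  have hvol := hg.profile_sq_le_vol hβ
  set M := ∫ y in (0 : ℝ)..(β / 2), g.profile y ^ 2 with hM
  rw [← hI] at hcs
  have hCb : C * b = I / 2 := by rw [hC]; field_simp
  have e2 : L / Real.pi * (I - C * b) + C * (l / 4) = I / 2 * (L / Real.pi + l / (4 * b)) := by
    rw [hCb, hC]; field_simp; ring
  rw [e2] at hsum
  have h7 : (I / 2 * (L / Real.pi + l / (4 * b))) ^ 2 ≤ M * I :=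
    (pow_le_pow_left₀ (by positivity) hsum 2).trans hcs
  -- The inequality 4xy ≤ (x + y)² with x = L/π and y = l/(4b).
  have h8 : I ^ 2 * (L * l / (4 * Real.pi * b)) ≤ (I / 2 * (L / Real.pi + l / (4 * b))) ^ 2 := by
    have : (I / 2 * (L / Real.pi + l / (4 * b))) ^ 2 - I ^ 2 * (L * l / (4 * Real.pi * b)) =
        (I / 2 * (L / Real.pi - l / (4 * b))) ^ 2 := by field_simp; ring
    nlinarith [sq_nonneg (I / 2 * (L / Real.pi - l / (4 * b)))]
  have h9 : I * (L * l / (4 * Real.pi * b)) ≤ M := by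
    refine le_of_mul_le_mul_left (a := I) ?_ hI0
    linarith
  rw [← mul_div_assoc, div_le_iff₀ (by positivity)] at h9
  have h10 : b * (4 * Real.pi * M) ≤ b * g.vol := mul_le_mul_of_nonneg_left hvol hb0.le
  linarith

end Metric

/-! ### Lower bounds for lengths by calibrating functions -/

/-- `h` grows at `z` at most at the rate `ρ z`. -/
def GrowthLE (h : ℂ → ℝ) (ρ : ℂ → ℝ) : Prop :=
  ∀ z, ∀ ε > 0, ∀ᶠ w in 𝓝 z, |h w - h z| ≤ (ρ z + ε) * ‖w - z‖

theorem GrowthLE.deriv_comp_le {h ρ : ℂ → ℝ} (hh : GrowthLE h ρ) (hρ : ∀ z, 0 ≤ ρ z) {γ : ℝ → ℂ}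
    {s : ℝ} (hγ : DifferentiableAt ℝ γ s) :
    deriv (fun s => h (γ s)) s ≤ ρ (γ s) * ‖deriv γ s‖ := by
  by_cases hd : DifferentiableAt ℝ (fun s => h (γ s)) s
  swap
  -- Where the composite is not differentiable, `deriv` takes the value 0 and the bound is trivial.
  · rw [deriv_zero_of_not_differentiableAt hd]
    exact mul_nonneg (hρ _) (norm_nonneg _)
  have key : ∀ ε > 0, deriv (fun s => h (γ s)) s ≤ (ρ (γ s) + ε) * ‖deriv γ s‖ := by
    intro ε hε
    have t1 := (hasDerivAt_iff_tendsto_slope.1 hd.hasDerivAt)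
    have t2 := (hasDerivAt_iff_tendsto_slope.1 hγ.hasDerivAt).norm.const_mul (ρ (γ s) + ε)
    refine le_of_tendsto_of_tendsto t1 t2 ?_
    have hev := (hγ.continuousAt.tendsto.mono_left (nhdsWithin_le_nhds (s := {s}ᶜ))).eventually (hh (γ s) ε hε)
    filter_upwards [hev] with r hr
    rw [slope_def_module, slope_def_module, norm_smul, smul_eq_mul, norm_inv, Real.norm_eq_abs]
    calc (r - s)⁻¹ * (h (γ r) - h (γ s)) ≤ |(r - s)⁻¹ * (h (γ r) - h (γ s))| := le_abs_self _
      _ = |r - s|⁻¹ * |h (γ r) - h (γ s)| := by rw [abs_mul, abs_inv]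
      _ ≤ |r - s|⁻¹ * ((ρ (γ s) + ε) * ‖γ r - γ s‖) := by gcongr
      _ = _ := by ring
  refine le_of_forall_pos_le_add fun δ hδ => ?_
  have h1 := key (δ / (‖deriv γ s‖ + 1)) (by positivity)
  have h2 : δ / (‖deriv γ s‖ + 1) * ‖deriv γ s‖ ≤ δ := by
    rw [div_mul_eq_mul_div, div_le_iff₀ (by positivity)]
    nlinarith [norm_nonneg (deriv γ s)]
  linarith

/-- The composite of h with a Lipschitz curve is Lipschitz, hence absolutely continuous, and is the
integral of its derivative. The pointwise growth bound is needed only almost everywhere, where the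
curve is differentiable. -/
theorem GrowthLE.sub_le_integral {h ρ : ℂ → ℝ} (hh : GrowthLE h ρ) (hloc : LocallyLipschitz h)
    (hρ : ∀ z, 0 ≤ ρ z) (hρc : Continuous ρ) {γ : ℝ → ℂ} {C : NNReal}
    (hγ : LipschitzOnWith C γ (Icc 0 1)) :
    h (γ 1) - h (γ 0) ≤ ∫ s in (0 : ℝ)..1, ρ (γ s) * ‖deriv γ s‖ := by
  obtain ⟨K, hK⟩ := hloc.locallyLipschitzOn.exists_lipschitzOnWith_of_compact
    (isCompact_Icc.image_of_continuousOn hγ.continuousOn)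
  have hF : LipschitzOnWith (K * C) (fun s => h (γ s)) (uIcc 0 1) := by
    rw [uIcc_of_le zero_le_one]
    exact hK.comp hγ (mapsTo_image _ _)
  have hAC := hF.absolutelyContinuousOnInterval
  have hInt : IntegrableOn (fun s => ρ (γ s) * ‖deriv γ s‖) (Icc 0 1) := by
    refine IntegrableOn.continuousOn_mul (hρc.comp_continuousOn hγ.continuousOn) ?_ isCompact_Icc
    rw [integrableOn_Icc_iff_integrableOn_Ioo]
    refine Measure.integrableOn_of_bounded (M := C) (by simp)
      (stronglyMeasurable_deriv γ).norm.aestronglyMeasurable ?_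
    refine (ae_restrict_iff' measurableSet_Ioo).2 (Eventually.of_forall fun s hs => ?_)
    rw [norm_norm]
    exact norm_deriv_le_of_lipschitzOn (Icc_mem_nhds hs.1 hs.2) hγ
  have hInt' : IntervalIntegrable (fun s => ρ (γ s) * ‖deriv γ s‖) volume 0 1 :=
    (intervalIntegrable_iff_integrableOn_Icc_of_le zero_le_one).2 hInt
  rw [← hAC.integral_deriv_eq_sub]
  refine intervalIntegral.integral_mono_ae_restrict zero_le_one hAC.intervalIntegrable_deriv hInt' ?_
  have hae := hγ.ae_differentiableWithinAt (μ := volume) measurableSet_Icc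
  rw [← restrict_Ioo_eq_restrict_Icc] at hae ⊢
  filter_upwards [hae, ae_restrict_mem measurableSet_Ioo] with s hs hs'
  exact hh.deriv_comp_le hρ (hs.differentiableAt (Icc_mem_nhds hs'.1 hs'.2))

/-- The calibrating function may depend on the starting point p; this permits distance functions
from p. -/
theorem Metric.IsConformal.le_leastLength {β : ℝ} {g : Metric β} (hg : g.IsConformal) {τ : ℂ → ℂ}
    {l : ℝ} (h : ∀ p, ∃ h : ℂ → ℝ, GrowthLE h g.density ∧ LocallyLipschitz h ∧
      l ≤ h (τ p) - h p) : l ≤ g.leastLength τ := by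
  refine le_csInf ?_ ?_
  -- The set of lengths must be nonempty for an infimum to be bounded below by l; the segment from 0
  -- to τ 0 is admissible.
  · obtain ⟨K, hK⟩ : ∃ K : NNReal, LipschitzWith K fun s : ℝ => s • (τ 0) :=
      ⟨_, ((ContinuousLinearMap.id ℝ ℝ).smulRight (τ 0)).lipschitz⟩
    exact ⟨_, fun s => s • τ 0, ⟨K, hK.lipschitzOnWith⟩, by simp, rfl⟩
  · rintro _ ⟨γ, ⟨C, hγ⟩, hτ, rfl⟩
    obtain ⟨h, h1, h2, h3⟩ := h (γ 0)
    rw [hg.length_eq]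
    refine h3.trans ?_
    rw [← hτ]
    exact h1.sub_le_integral h2 (fun z => (g.density_pos z).le) g.continuous_density hγ

/-! ### The round sphere in Mercator coordinates -/

/-- The point of the unit sphere with longitude `x` and Mercator latitude `y`. -/
noncomputable def mercator (z : ℂ) : EuclideanSpace ℝ (Fin 3) :=
  !₂[Real.cos z.re / Real.cosh z.im, Real.sin z.re / Real.cosh z.im,
    Real.sinh z.im / Real.cosh z.im]

theorem inner_mercator (z w : ℂ) : inner ℝ (mercator z) (mercator w) =
    1 - (Real.cosh (z.im - w.im) - Real.cos (z.re - w.re)) /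
      (Real.cosh z.im * Real.cosh w.im) := by
  have h1 := (Real.cosh_pos z.im).ne'
  have h2 := (Real.cosh_pos w.im).ne'
  simp only [mercator, PiLp.inner_apply, Fin.sum_univ_three]
  simp
  rw [Real.cosh_sub, Real.cos_sub]
  field_simp
  ring

theorem norm_mercator (z : ℂ) : ‖mercator z‖ = 1 := by
  have := real_inner_self_eq_norm_sq (mercator z)
  rw [inner_mercator] at this
  simp at this
  nlinarith [norm_nonneg (mercator z)]

theorem mercator_ne_zero (z : ℂ) : mercator z ≠ 0 := by
  intro h
  have := norm_mercator z
  simp [h] at this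

theorem mercator_glide (z : ℂ) : mercator (glide z) = -mercator z := by
  ext i
  fin_cases i <;> simp [mercator, glide, neg_div]

open InnerProductGeometry in
-- The left side is (cosh Δy - cos Δx)/(cosh y cosh y'). The numerator is estimated by cosh s ≤
-- exp(s²/2) and cos s ≥ 1 - s²/2, which keeps the leading coefficient sharp.
theorem one_sub_cos_angle_mercator_le {z w : ℂ} (h : ‖w - z‖ ≤ 1) :
    1 - Real.cos (angle (mercator z) (mercator w)) ≤
      1 / (Real.cosh z.im * Real.cosh w.im) * (‖w - z‖ ^ 2 / 2 * (1 + ‖w - z‖ ^ 2 / 2)) := by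
  rw [cos_angle, norm_mercator, norm_mercator, inner_mercator]
  have h1 := Real.cosh_pos z.im
  have h2 := Real.cosh_pos w.im
  set y := z.im - w.im
  set x := z.re - w.re
  have hn : ‖w - z‖ ^ 2 = x ^ 2 + y ^ 2 := by
    rw [← Complex.normSq_eq_norm_sq, Complex.normSq_apply]
    simp only [Complex.sub_re, Complex.sub_im, x, y]; ring
  have hle : ‖w - z‖ ^ 2 ≤ 1 := pow_le_one₀ (norm_nonneg _) h
  rw [hn] at hle ⊢
  have h3 := Real.cosh_le_exp_half_sq y
  have h4 := Real.one_sub_sq_div_two_le_cos (x := x)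
  have h5 := (abs_le.1 (Real.abs_exp_sub_one_sub_id_le (x := y ^ 2 / 2)
    (by rw [abs_of_nonneg (by positivity)]; nlinarith [sq_nonneg x]))).2
  have h6 : Real.cosh y - Real.cos x ≤ (x ^ 2 + y ^ 2) / 2 * (1 + (x ^ 2 + y ^ 2) / 2) := by
    nlinarith [mul_nonneg (sq_nonneg x) (sq_nonneg y), sq_nonneg (x ^ 2)]
  calc 1 - (1 - (Real.cosh y - Real.cos x) / (Real.cosh z.im * Real.cosh w.im)) / (1 * 1)
      = 1 / (Real.cosh z.im * Real.cosh w.im) * (Real.cosh y - Real.cos x) := by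
        field_simp; ring
    _ ≤ _ := by gcongr

open InnerProductGeometry in
-- A crude bound, used only for local Lipschitz continuity; it follows from 1 - cos θ ≥ 2θ²/π².
theorem angle_mercator_le {z w : ℂ} (h : ‖w - z‖ ≤ 1) :
    angle (mercator z) (mercator w) ≤ 2 * ‖w - z‖ := by
  have h1 := one_sub_cos_angle_mercator_le h
  set θ := angle (mercator z) (mercator w)
  have h0 : 0 ≤ θ := angle_nonneg _ _
  have hπ : θ ≤ Real.pi := angle_le_pi _ _
  have h3 := Real.cos_le_one_sub_mul_cos_sq (x := θ) (by rwa [abs_of_nonneg h0])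
  have h4 : 1 / (Real.cosh z.im * Real.cosh w.im) ≤ 1 := by
    rw [div_le_one (mul_pos (Real.cosh_pos _) (Real.cosh_pos _))]
    exact one_le_mul_of_one_le_of_one_le (Real.one_le_cosh _) (Real.one_le_cosh _)
  have hle : ‖w - z‖ ^ 2 ≤ 1 := pow_le_one₀ (norm_nonneg _) h
  have h5 : 2 / Real.pi ^ 2 * θ ^ 2 ≤ 3 / 4 * ‖w - z‖ ^ 2 := by
    have : 1 / (Real.cosh z.im * Real.cosh w.im) * (‖w - z‖ ^ 2 / 2 * (1 + ‖w - z‖ ^ 2 / 2)) ≤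
        1 * (‖w - z‖ ^ 2 / 2 * (1 + ‖w - z‖ ^ 2 / 2)) := by gcongr
    nlinarith [sq_nonneg ‖w - z‖]
  have h6 : θ ^ 2 ≤ (2 * ‖w - z‖) ^ 2 := by
    rw [div_mul_eq_mul_div, div_le_iff₀ (by positivity)] at h5
    have h7 : Real.pi ^ 2 ≤ 10 := by
      nlinarith [Real.pi_lt_d2, Real.pi_pos]
    nlinarith [sq_nonneg ‖w - z‖]
  exact le_of_sq_le_sq h6 (by positivity)

open InnerProductGeometry in
theorem abs_angle_sub_angle_le {V : Type*} [NormedAddCommGroup V] [InnerProductSpace ℝ V]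
    (p x y : V) : |angle p y - angle p x| ≤ angle x y := by
  have h1 := angle_le_angle_add_angle p x y
  have h2 := angle_le_angle_add_angle p y x
  rw [angle_comm y x] at h2
  rw [abs_le]
  constructor <;> linarith

open InnerProductGeometry in
theorem locallyLipschitz_angle_mercator (p : EuclideanSpace ℝ (Fin 3)) :
    LocallyLipschitz fun z => angle p (mercator z) := by
  intro z
  refine ⟨2, Metric.ball z (1 / 2), Metric.ball_mem_nhds z (by norm_num), ?_⟩
  refine LipschitzOnWith.of_dist_le_mul fun v hv w hw => ?_
  have hvw : dist v w ≤ 1 := by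
    have := dist_triangle_right v w z
    rw [Metric.mem_ball] at hv hw
    linarith
  rw [dist_comm, Real.dist_eq, dist_eq_norm, norm_sub_rev]
  rw [dist_comm, dist_eq_norm] at hvw
  exact (abs_angle_sub_angle_le _ _ _).trans (angle_mercator_le hvw)

open InnerProductGeometry in
theorem growthLE_angle_mercator (p : EuclideanSpace ℝ (Fin 3)) :
    GrowthLE (fun z => angle p (mercator z)) fun z => 1 / Real.cosh z.im := by
  intro z ε hε
  have hz := Real.cosh_pos z.im
  set r := 1 / Real.cosh z.im + ε with hr
  have hr0 : 0 < r := by positivity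
  have c0 : ContinuousAt (fun w : ℂ => ‖w - z‖) z := by fun_prop
  have e1 : ∀ᶠ w in 𝓝 z, ‖w - z‖ < 1 := c0.eventually_lt continuousAt_const (by simp)
  have e2 : ∀ᶠ w in 𝓝 z, r * ‖w - z‖ < 1 :=
    (continuousAt_const.mul c0).eventually_lt continuousAt_const (by simp)
  -- An angle exceeding r d, with d = ‖w - z‖, would have 1 - cos at least (d²/2) r² (1 - (5/48)(r
  -- d)²), by the quartic Taylor error of the cosine. Near z this exceeds the upper bound on 1 -
  -- cos, because r > 1/cosh y.
  have e3 : ∀ᶠ w in 𝓝 z, 1 / (Real.cosh z.im * Real.cosh w.im) * (1 + ‖w - z‖ ^ 2 / 2) <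
      r ^ 2 * (1 - 5 / 48 * (r * ‖w - z‖) ^ 2) := by
    refine ContinuousAt.eventually_lt (ContinuousAt.mul (Continuous.continuousAt ?_) (by fun_prop))
      (by fun_prop) ?_
    · refine continuous_const.div ?_ fun w => (mul_pos hz (Real.cosh_pos _)).ne'
      exact continuous_const.mul (Real.continuous_cosh.comp Complex.continuous_im)
    · have : (1 / Real.cosh z.im) ^ 2 < r ^ 2 :=
        pow_lt_pow_left₀ (by rw [hr]; linarith) (by positivity) two_ne_zero
      simpa [← sq] using this
  filter_upwards [e1, e2, e3] with w h1 h2 h3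
  refine (abs_angle_sub_angle_le _ _ _).trans ?_
  set d := ‖w - z‖ with hd
  have hd0 : 0 ≤ d := norm_nonneg _
  have hη0 : 0 ≤ r * d := by positivity
  by_contra! hlt
  have hcos := Real.cos_lt_cos_of_nonneg_of_le_pi hη0 (angle_le_pi _ _) hlt
  have h4 := one_sub_cos_angle_mercator_le (z := z) (w := w) h1.le
  have h5 := (abs_le.1 (Real.cos_bound (x := r * d) (by rw [abs_of_nonneg hη0]; exact h2.le))).2
  rw [abs_of_nonneg hη0] at h5
  have h6 := mul_le_mul_of_nonneg_left h3.le (by positivity : 0 ≤ d ^ 2 / 2)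
  rw [← hd] at h4
  nlinarith

theorem GrowthLE.comp {h ρ ρ' : ℂ → ℝ} (hh : GrowthLE h ρ) {F : ℂ → ℂ} (hF : LipschitzWith 1 F)
    (hρ : ∀ z, 0 ≤ ρ z) (hle : ∀ z, ρ (F z) ≤ ρ' z) : GrowthLE (fun z => h (F z)) ρ' := by
  intro z ε hε
  filter_upwards [hF.continuous.continuousAt.eventually (hh (F z) ε hε)] with w hw
  have h1 : ‖F w - F z‖ ≤ ‖w - z‖ := by simpa [dist_eq_norm] using hF.dist_le_mul w z
  have h2 := hρ (F z)
  calc _ ≤ _ := hw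
    _ ≤ (ρ (F z) + ε) * ‖w - z‖ := by gcongr
    _ ≤ _ := by gcongr; exact hle z

/-! ### Folding the plane onto a strip -/

theorem latticeDist_add_int_mul (b v : ℝ) (n : ℤ) :
    latticeDist b (v + n * (2 * b)) = latticeDist b v := by
  have h : Function.Periodic (latticeDist b) (2 * b) := fun v => by
    simp only [latticeDist, AddCircle.coe_add_period]
  exact h.int_mul n v

theorem latticeDist_eq_abs {b v : ℝ} (h : |v| ≤ b) : latticeDist b v = |v| := by
  have hb : 0 ≤ b := (abs_nonneg v).trans h
  rcases hb.eq_or_lt with rfl | hb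
  · have : v = 0 := abs_eq_zero.1 (le_antisymm h (abs_nonneg v))
    simp [latticeDist, this]
  · refine (AddCircle.norm_coe_eq_abs_iff (2 * b) (by positivity)).2 ?_
    rw [abs_of_pos (by positivity : 0 < 2 * b)]
    linarith

theorem abs_latticeDist_sub_le (b v w : ℝ) :
    |latticeDist b v - latticeDist b w| ≤ |v - w| := by
  refine (abs_norm_sub_norm_le _ _).trans ?_
  rw [← AddCircle.coe_sub]
  exact (QuotientAddGroup.norm_mk_le_norm (S := AddSubgroup.zmultiples (2 * b)) (m := v - w)).trans_eq
    (Real.norm_eq_abs _)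

theorem exists_eq_add_int_mul {b : ℝ} (hb : 0 < b) (v c : ℝ) :
    ∃ (w : ℝ) (n : ℤ), v = w + n * (2 * b) ∧ c ≤ w ∧ w ≤ c + 2 * b := by
  have hp : 0 < 2 * b := by positivity
  refine ⟨toIcoMod hp c v, toIcoDiv hp c v, ?_, left_le_toIcoMod hp c v,
    (toIcoMod_lt_right hp c v).le⟩
  have := toIcoMod_add_toIcoDiv_zsmul hp c v
  rw [zsmul_eq_mul] at this
  exact this.symm

/-- The `2β`-periodic zigzag function equal to `y` on `|y| ≤ β/2` and to `β - y` on
`β/2 ≤ y ≤ 3β/2`. -/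
noncomputable def fold (β y : ℝ) : ℝ := latticeDist β (y + β / 2) - β / 2

theorem fold_add_int_mul (β y : ℝ) (n : ℤ) : fold β (y + n * (2 * β)) = fold β y := by
  rw [fold, fold, ← latticeDist_add_int_mul β (y + β / 2) n]
  congr 2; ring

theorem fold_of_abs_le {β y : ℝ} (h : |y| ≤ β / 2) : fold β y = y := by
  have h' := abs_le.1 h
  rw [fold, latticeDist_eq_abs, abs_of_nonneg] <;> [ring; linarith; (rw [abs_le]; constructor <;> linarith)]

theorem fold_of_abs_sub_le {β y : ℝ} (h : |y - β| ≤ β / 2) : fold β y = β - y := by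
  have h' := abs_le.1 h
  have e := latticeDist_add_int_mul β (y + β / 2 - 2 * β) 1
  rw [show y + β / 2 - 2 * β + (1 : ℤ) * (2 * β) = y + β / 2 by push_cast; ring] at e
  rw [fold, e, latticeDist_eq_abs, abs_of_nonpos] <;>
    [ring; linarith; (rw [abs_le]; constructor <;> linarith)]

theorem exists_fold_cases {β : ℝ} (hβ : 0 < β) (y : ℝ) :
    ∃ (w : ℝ) (n : ℤ), y = w + n * (2 * β) ∧ (|w| ≤ β / 2 ∨ |w - β| ≤ β / 2) := by
  obtain ⟨w, n, rfl, h1, h2⟩ := exists_eq_add_int_mul hβ y (-(β / 2))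
  refine ⟨w, n, rfl, ?_⟩
  rcases le_total w (β / 2) with h | h
  · left; rw [abs_le]; constructor <;> linarith
  · right; rw [abs_le]; constructor <;> linarith

theorem fold_neg {β : ℝ} (hβ : 0 < β) (y : ℝ) : fold β (-y) = -fold β y := by
  obtain ⟨w, n, rfl, h | h⟩ := exists_fold_cases hβ y
  · rw [fold_add_int_mul, fold_of_abs_le h,
      show -(w + n * (2 * β)) = -w + ((-n : ℤ) : ℝ) * (2 * β) by push_cast; ring,
      fold_add_int_mul, fold_of_abs_le (by rwa [abs_neg])]
  · rw [fold_add_int_mul, fold_of_abs_sub_le h,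
      show -(w + n * (2 * β)) = (2 * β - w) + ((-n - 1 : ℤ) : ℝ) * (2 * β) by push_cast; ring,
      fold_add_int_mul, fold_of_abs_sub_le]
    · ring
    · rw [← abs_neg]; convert h using 2; ring

theorem abs_fold {β : ℝ} (hβ : 0 < β) (y : ℝ) : |fold β y| = latticeDist (β / 2) y := by
  obtain ⟨w, n, rfl, h | h⟩ := exists_fold_cases hβ y
  · rw [fold_add_int_mul, fold_of_abs_le h,
      show w + n * (2 * β) = w + ((2 * n : ℤ) : ℝ) * (2 * (β / 2)) by push_cast; ring,
      latticeDist_add_int_mul, latticeDist_eq_abs h]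
  · rw [fold_add_int_mul, fold_of_abs_sub_le h,
      show w + n * (2 * β) = (w - β) + ((2 * n + 1 : ℤ) : ℝ) * (2 * (β / 2)) by push_cast; ring,
      latticeDist_add_int_mul, latticeDist_eq_abs h, abs_sub_comm]

theorem abs_fold_sub_le (β v w : ℝ) : |fold β v - fold β w| ≤ |v - w| := by
  have := abs_latticeDist_sub_le β (v + β / 2) (w + β / 2)
  simpa [fold] using this

/-- The zigzag map of the plane onto the strip `|y| ≤ β/2`. -/
noncomputable def foldMap (β : ℝ) (z : ℂ) : ℂ := ⟨z.re, fold β z.im⟩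

theorem lipschitzWith_foldMap (β : ℝ) : LipschitzWith 1 (foldMap β) := by
  refine LipschitzWith.of_dist_le_mul fun z w => ?_
  rw [NNReal.coe_one, one_mul, Complex.dist_eq_re_im, Complex.dist_eq_re_im]
  refine Real.sqrt_le_sqrt ?_
  have := sq_le_sq.2 (abs_fold_sub_le β z.im w.im)
  simp only [foldMap]
  linarith

theorem foldMap_glide {β : ℝ} (hβ : 0 < β) (z : ℂ) : foldMap β (glide z) = glide (foldMap β z) := by
  apply Complex.ext <;> simp [foldMap, glide, fold_neg hβ]

/-- Since t becomes trivial after folding, σ and tσ both become the antipodal map of the sphere, and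
one calibration serves both classes. -/
theorem foldMap_vert (β : ℝ) (z : ℂ) : foldMap β (vert β z) = foldMap β z := by
  have := fold_add_int_mul β z.im 1
  apply Complex.ext <;> simp [foldMap, vert]
  simpa using this

/-! ### The extremal metrics: volume and least lengths -/

/-- The conformal factor of the extremal metrics as a function of the height. -/
noncomputable def extremalProfile (β a y : ℝ) : ℝ := capProfile a (latticeDist (β / 2) y)

theorem continuous_extremalProfile (β a : ℝ) : Continuous (extremalProfile β a) :=
  (continuous_capProfile a).comp (latticeDist_continuous _)

theorem extremalProfile_pos (β a y : ℝ) : 0 < extremalProfile β a y := capProfile_pos _ _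

theorem extremalProfile_neg (β a y : ℝ) : extremalProfile β a (-y) = extremalProfile β a y := by
  rw [extremalProfile, latticeDist_neg, extremalProfile]

theorem extremalProfile_add (β a y : ℝ) : extremalProfile β a (y + β) = extremalProfile β a y := by
  have := latticeDist_add_int_mul (β / 2) y 1
  rw [show y + (1 : ℤ) * (2 * (β / 2)) = y + β by push_cast; ring] at this
  rw [extremalProfile, this, extremalProfile]

theorem extremalProfile_add_two_mul (β a y : ℝ) :
    extremalProfile β a (y + 2 * β) = extremalProfile β a y := by
  rw [two_mul, ← add_assoc, extremalProfile_add, extremalProfile_add]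

theorem extremalProfile_of_mem {β a y : ℝ} (hy : y ∈ Icc 0 (β / 2)) :
    extremalProfile β a y = capProfile a y := by
  have h : |y| ≤ β / 2 := by rw [abs_of_nonneg hy.1]; exact hy.2
  rw [extremalProfile, latticeDist_eq_abs h, abs_of_nonneg hy.1]

/-- Folding followed by `mercator` does not increase lengths for the extremal metric: the folded
height has absolute value equal to the distance to βℤ, and truncation at a only enlarges the
density. -/
theorem one_div_cosh_fold_le {β a : ℝ} (hβ : 0 < β) (ha : 0 ≤ a) (y : ℝ) :
    1 / Real.cosh (fold β y) ≤ extremalProfile β a y := by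
  rw [extremalProfile, capProfile, ← Real.cosh_abs (fold β y), abs_fold hβ]
  refine one_div_le_one_div_of_le (Real.cosh_pos _) (Real.cosh_le_cosh.2 ?_)
  have h0 := latticeDist_nonneg (β / 2) y
  rw [abs_of_nonneg h0, abs_of_nonneg (le_min h0 ha)]
  exact min_le_left _ _

theorem half_le_extremalProfile {β a : ℝ} (ha : 0 ≤ a) (hcosh : Real.cosh a ≤ 2) (y : ℝ) :
    1 / 2 ≤ extremalProfile β a y := by
  refine one_div_le_one_div_of_le (Real.cosh_pos _) (le_trans (Real.cosh_le_cosh.2 ?_) hcosh)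
  have h0 := latticeDist_nonneg (β / 2) y
  rw [abs_of_nonneg (le_min h0 ha), abs_of_nonneg ha]
  exact min_le_right _ _

/-- The extremal metric in its conformal class: spherical for `a = β/2`, flat-spherical for
`cosh a = 2`. -/
noncomputable def extremal (β a : ℝ) : Metric β where
  form z := extremalProfile β a z.im ^ 2 • (flat β).form z
  symm z v w := by
    simp only [LinearMap.smul_apply, (flat β).symm z v w]
  pos z v hv := by
    simp only [LinearMap.smul_apply, smul_eq_mul]
    exact mul_pos (pow_pos (extremalProfile_pos _ _ _) 2) ((flat β).pos z v hv)
  continuous v w := by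
    simp only [LinearMap.smul_apply, smul_eq_mul]
    exact (((continuous_extremalProfile β a).comp Complex.continuous_im).pow 2).mul
      ((flat β).continuous v w)
  glide_invariant z v w := by
    have : (glide z).im = -z.im := by simp [glide]
    simp only [LinearMap.smul_apply, (flat β).glide_invariant, this, extremalProfile_neg]
  vert_invariant z v w := by
    have : (vert β z).im = z.im + 2 * β := by simp [vert]
    simp only [LinearMap.smul_apply, (flat β).vert_invariant, this, extremalProfile_add_two_mul]

theorem extremal_form (β a : ℝ) (z v w : ℂ) :
    (extremal β a).form z v w = extremalProfile β a z.im ^ 2 * (v.re * w.re + v.im * w.im) := by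
  simp [extremal, flat, warped, warpedForm_apply]

theorem extremal_isConformal (β a : ℝ) : (extremal β a).IsConformal :=
  ⟨fun z => extremalProfile β a z.im ^ 2, fun _ => pow_pos (extremalProfile_pos _ _ _) 2,
    fun z v w => by simp [extremal]⟩

theorem extremal_density (β a : ℝ) (z : ℂ) :
    (extremal β a).density z = extremalProfile β a z.im := by
  rw [Metric.density, extremal_form]
  simp [Real.sqrt_sq (extremalProfile_pos β a z.im).le]

theorem integral_comp_extremalProfile {F : ℝ → ℝ} (hF : Continuous F) {β : ℝ} (hβ : 0 < β) (a : ℝ) :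
    ∫ y in (0 : ℝ)..(2 * β), F (extremalProfile β a y) =
      4 * ∫ y in (0 : ℝ)..(β / 2), F (capProfile a y) := by
  have hc : Continuous fun y => F (extremalProfile β a y) := hF.comp (continuous_extremalProfile β a)
  rw [Metric.integral_two_mul hc]
  simp only [extremalProfile_add, ← two_mul]
  rw [intervalIntegral.integral_const_mul, Metric.integral_half_of_symm hc fun y => by
    rw [sub_eq_neg_add, extremalProfile_add, extremalProfile_neg]]
  have : ∫ y in (0 : ℝ)..(β / 2), F (extremalProfile β a y) =
      ∫ y in (0 : ℝ)..(β / 2), F (capProfile a y) := by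
    refine intervalIntegral.integral_congr fun y hy => ?_
    rw [uIcc_of_le (by positivity)] at hy
    simp only [extremalProfile_of_mem hy]
  rw [this]; ring

theorem extremal_vol {β : ℝ} (hβ : 0 < β) (a : ℝ) :
    (extremal β a).vol = 4 * Real.pi * ∫ y in (0 : ℝ)..(β / 2), capProfile a y ^ 2 := by
  rw [(extremal_isConformal β a).vol_eq hβ]
  simp only [extremal_density, intervalIntegral.integral_const, sub_zero, smul_eq_mul]
  rw [intervalIntegral.integral_const_mul,
    integral_comp_extremalProfile (F := fun p => p ^ 2) (by fun_prop) hβ]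
  ring

/-- The distance from the equator, as a function of the conformal height. -/
noncomputable def extremalHeight (β a y : ℝ) : ℝ := ∫ s in (0 : ℝ)..y, extremalProfile β a s

theorem hasDerivAt_extremalHeight (β a y : ℝ) :
    HasDerivAt (extremalHeight β a) (extremalProfile β a y) y :=
  intervalIntegral.integral_hasDerivAt_right
    ((continuous_extremalProfile β a).intervalIntegrable _ _)
    ((continuous_extremalProfile β a).stronglyMeasurableAtFilter _ _)
    (continuous_extremalProfile β a).continuousAt

theorem contDiff_extremalHeight (β a : ℝ) : ContDiff ℝ 1 (extremalHeight β a) := by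
  rw [contDiff_one_iff_deriv]
  refine ⟨fun y => (hasDerivAt_extremalHeight β a y).differentiableAt, ?_⟩
  rw [funext fun y => (hasDerivAt_extremalHeight β a y).deriv]
  exact continuous_extremalProfile β a

theorem growthLE_comp_im {V v : ℝ → ℝ} (hV : ∀ y, HasDerivAt V (v y) y) (hv : ∀ y, 0 ≤ v y) :
    GrowthLE (fun z => V z.im) fun z => v z.im := by
  intro z ε hε
  have h1 := (hV z.im).isLittleO.def hε
  filter_upwards [Complex.continuous_im.continuousAt.eventually h1] with w hw
  have h2 : |w.im - z.im| ≤ ‖w - z‖ := by simpa using Complex.abs_im_le_norm (w - z)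
  rw [smul_eq_mul, Real.norm_eq_abs, Real.norm_eq_abs] at hw
  have h3 := abs_add_le (V w.im - V z.im - (w.im - z.im) * v z.im) ((w.im - z.im) * v z.im)
  rw [sub_add_cancel, abs_mul, abs_of_nonneg (hv _)] at h3
  have h4 := hv z.im
  calc |V w.im - V z.im| ≤ (v z.im + ε) * |w.im - z.im| := by linarith
    _ ≤ _ := by gcongr

theorem extremal_le_lV {β : ℝ} (hβ : 0 < β) (a : ℝ) :
    4 * ∫ y in (0 : ℝ)..(β / 2), capProfile a y ≤ (extremal β a).lV := by
  refine (extremal_isConformal β a).le_leastLength fun p =>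
    ⟨fun z => extremalHeight β a z.im, ?_, ?_, ?_⟩
  · rw [funext (extremal_density β a)]
    exact growthLE_comp_im (hasDerivAt_extremalHeight β a) fun y => (extremalProfile_pos β a y).le
  · exact ((contDiff_extremalHeight β a).comp Complex.imCLM.contDiff).locallyLipschitz
  · have e : (vert β p).im = p.im + 2 * β := by simp [vert]
    have hp : Function.Periodic (extremalProfile β a) (2 * β) := extremalProfile_add_two_mul β a
    have hc := continuous_extremalProfile β a
    simp only [e]
    rw [extremalHeight, extremalHeight,
      intervalIntegral.integral_interval_sub_left (hc.intervalIntegrable _ _)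
        (hc.intervalIntegrable _ _), hp.intervalIntegral_add_eq p.im 0, zero_add,
      integral_comp_extremalProfile (F := fun p => p) continuous_id hβ]

/-- The density is at least 1/2, so x/2 is a calibration; it grows by π along the displacement 2π of
σ². -/
theorem extremal_pi_le_lH {β a : ℝ} (ha : 0 ≤ a) (hcosh : Real.cosh a ≤ 2) :
    Real.pi ≤ (extremal β a).lH := by
  refine (extremal_isConformal β a).le_leastLength fun p => ⟨fun z => 1 / 2 * z.re, ?_, ?_, ?_⟩
  · intro z ε hε
    refine Eventually.of_forall fun w => ?_
    have h1 := half_le_extremalProfile (β := β) ha hcosh z.im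
    have h2 : |w.re - z.re| ≤ ‖w - z‖ := by simpa using Complex.abs_re_le_norm (w - z)
    rw [extremal_density, ← mul_sub, abs_mul, abs_of_pos (by norm_num : (0 : ℝ) < 1 / 2)]
    gcongr
    linarith
  · exact (contDiff_const.mul Complex.reCLM.contDiff :
      ContDiff ℝ 1 fun z : ℂ => 1 / 2 * z.re).locallyLipschitz
  · simp [glide]; linarith

open InnerProductGeometry in
-- The calibration is the spherical distance from the folded starting point, which reaches π at the
-- antipode.
theorem extremal_pi_le_leastLength {β a : ℝ} (hβ : 0 < β) (ha : 0 ≤ a) {τ : ℂ → ℂ}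
    (hτ : ∀ p, foldMap β (τ p) = glide (foldMap β p)) :
    Real.pi ≤ (extremal β a).leastLength τ := by
  refine (extremal_isConformal β a).le_leastLength fun p =>
    ⟨fun z => angle (mercator (foldMap β p)) (mercator (foldMap β z)), ?_, ?_, ?_⟩
  · refine (growthLE_angle_mercator (mercator (foldMap β p))).comp (lipschitzWith_foldMap β)
      (fun z => (one_div_pos.2 (Real.cosh_pos _)).le) fun z => ?_
    rw [extremal_density]
    exact one_div_cosh_fold_le hβ ha z.im
  · exact (locallyLipschitz_angle_mercator _).comp (lipschitzWith_foldMap β).locallyLipschitz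
  · simp only [hτ]
    rw [mercator_glide, angle_self_neg_of_nonzero (mercator_ne_zero _),
      angle_self (mercator_ne_zero _), sub_zero]

theorem extremal_pi_le_LSigma {β a : ℝ} (hβ : 0 < β) (ha : 0 ≤ a) (hcosh : Real.cosh a ≤ 2) :
    Real.pi ≤ (extremal β a).LSigma :=
  le_min (le_min (extremal_pi_le_leastLength hβ ha (foldMap_glide hβ))
    (extremal_pi_le_leastLength hβ ha fun p => by
      rw [Function.comp_apply, foldMap_vert, foldMap_glide hβ])) (extremal_pi_le_lH ha hcosh)

theorem extremal_LSigma_mul_lV {β a : ℝ} (ha : 0 < a) (haβ : a ≤ β / 2) (hcosh : Real.cosh a ≤ 2)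
    (h : a = β / 2 ∨ Real.cosh a = 2) :
    (extremal β a).LSigma * (extremal β a).lV * (∫ y in (0 : ℝ)..(β / 2), capProfile a y ^ 2) =
      (∫ y in (0 : ℝ)..(β / 2), capProfile a y) * (extremal β a).vol := by
  have hβ : 0 < β := by linarith
  refine le_antisymm ((extremal_isConformal β a).LSigma_mul_lV_le ha haβ hcosh h) ?_
  have h1 := extremal_pi_le_LSigma hβ ha.le hcosh
  have h2 := extremal_le_lV hβ a
  have h3 : 0 ≤ ∫ y in (0 : ℝ)..(β / 2), capProfile a y ^ 2 :=
    intervalIntegral.integral_nonneg (by positivity) fun _ _ => sq_nonneg _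
  have h4 : 0 ≤ ∫ y in (0 : ℝ)..(β / 2), capProfile a y :=
    intervalIntegral.integral_nonneg (by positivity) fun _ _ => (capProfile_pos _ _).le
  rw [extremal_vol hβ]
  calc _ = Real.pi * (4 * ∫ y in (0 : ℝ)..(β / 2), capProfile a y) *
        ∫ y in (0 : ℝ)..(β / 2), capProfile a y ^ 2 := by ring
    _ ≤ _ := mul_le_mul_of_nonneg_right (mul_le_mul h1 h2 (by positivity)
        (Real.pi_pos.le.trans h1)) h3

/-! ### Isometry with the spherical and flat-spherical models -/

theorem extremalHeight_sub (β a x y : ℝ) :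
    extremalHeight β a y - extremalHeight β a x = ∫ s in x..y, extremalProfile β a s :=
  intervalIntegral.integral_interval_sub_left
    ((continuous_extremalProfile β a).intervalIntegrable _ _)
    ((continuous_extremalProfile β a).intervalIntegrable _ _)

theorem extremalHeight_neg (β a y : ℝ) : extremalHeight β a (-y) = -extremalHeight β a y := by
  have h := intervalIntegral.integral_comp_neg (a := 0) (b := y) (extremalProfile β a)
  simp only [extremalProfile_neg, neg_zero] at h
  rw [extremalHeight, intervalIntegral.integral_symm, ← h, extremalHeight]

theorem extremalHeight_strictMono (β a : ℝ) : StrictMono (extremalHeight β a) :=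
  strictMono_of_deriv_pos fun y => by
    rw [(hasDerivAt_extremalHeight β a y).deriv]; exact extremalProfile_pos β a y

theorem extremalHeight_abs (β a y : ℝ) : |extremalHeight β a y| = extremalHeight β a |y| := by
  have h0 : extremalHeight β a 0 = 0 := by simp [extremalHeight]
  have hm := (extremalHeight_strictMono β a).monotone
  rcases le_total 0 y with h | h
  · rw [abs_of_nonneg h, abs_of_nonneg (h0 ▸ hm h)]
  · rw [abs_of_nonpos h, abs_of_nonpos (h0 ▸ hm h), extremalHeight_neg]

theorem extremalHeight_half {β : ℝ} (hβ : 0 < β) (a : ℝ) :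
    extremalHeight β a (β / 2) = ∫ y in (0 : ℝ)..(β / 2), capProfile a y := by
  refine intervalIntegral.integral_congr fun y hy => ?_
  rw [uIcc_of_le (by positivity)] at hy
  exact extremalProfile_of_mem hy

theorem extremalHeight_add {β : ℝ} (hβ : 0 < β) (a y : ℝ) :
    extremalHeight β a (y + β) =
      extremalHeight β a y + 2 * ∫ y in (0 : ℝ)..(β / 2), capProfile a y := by
  have hp : Function.Periodic (extremalProfile β a) β := extremalProfile_add β a
  have h := extremalHeight_sub β a y (y + β)
  rw [hp.intervalIntegral_add_eq y (-(β / 2)),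
    show -(β / 2) + β = β / 2 by ring,
    integral_even (continuous_extremalProfile β a) (extremalProfile_neg β a)] at h
  have e := extremalHeight_half hβ a
  rw [extremalHeight] at e
  rw [e] at h
  linarith

theorem extremalHeight_add_int_mul {β : ℝ} (hβ : 0 < β) (a y : ℝ) (n : ℤ) :
    extremalHeight β a (y + n * β) =
      extremalHeight β a y + n * (2 * ∫ y in (0 : ℝ)..(β / 2), capProfile a y) := by
  set b := ∫ y in (0 : ℝ)..(β / 2), capProfile a y with hb
  -- Subtracting the mean slope 2b/β leaves a β-periodic function.
  have hp : Function.Periodic (fun y => extremalHeight β a y - 2 * b / β * y) β := fun y => by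
    simp only [extremalHeight_add hβ, ← hb]
    field_simp
    ring
  have h := hp.int_mul n y
  have e : 2 * b / β * (y + n * β) = 2 * b / β * y + n * (2 * b) := by field_simp
  simp only [e] at h
  linarith

theorem extremalHeight_of_le {β a y : ℝ} (haβ : a ≤ β / 2) (h0 : 0 ≤ y) (hy : y ≤ a) :
    extremalHeight β a y = Real.arctan (Real.sinh y) := by
  have h := integral_one_div_cosh 0 y
  rw [Real.sinh_zero, Real.arctan_zero, sub_zero] at h
  rw [← h]
  refine intervalIntegral.integral_congr fun s hs => ?_
  rw [uIcc_of_le h0] at hs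
  simp only [extremalProfile_of_mem (a := a) ⟨hs.1, hs.2.trans (hy.trans haβ)⟩, capProfile,
    min_eq_left (hs.2.trans hy)]

theorem latticeDist_extremalHeight {β b : ℝ} (hβ : 0 < β) {a : ℝ}
    (hb : b = ∫ y in (0 : ℝ)..(β / 2), capProfile a y) (y : ℝ) :
    latticeDist b (extremalHeight β a y) = extremalHeight β a (latticeDist (β / 2) y) := by
  obtain ⟨w, n, rfl, h1, h2⟩ := exists_eq_add_int_mul (half_pos hβ) y (-(β / 2))
  have hw : |w| ≤ β / 2 := abs_le.2 ⟨h1, by linarith⟩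
  have hV : |extremalHeight β a w| ≤ b := by
    rw [extremalHeight_abs, hb, ← extremalHeight_half hβ]
    exact (extremalHeight_strictMono β a).monotone hw
  rw [latticeDist_add_int_mul, latticeDist_eq_abs hw, mul_div_cancel₀ β two_ne_zero,
    extremalHeight_add_int_mul hβ, ← hb, latticeDist_add_int_mul, latticeDist_eq_abs hV,
    extremalHeight_abs]

/-- On [0, a] the height is the Gudermannian arctan(sinh y), whose cosine is 1/cosh y. The height is
monotone, so truncating it at its value at a is truncating y at a. -/
theorem cos_min_latticeDist_extremalHeight {β b : ℝ} {a : ℝ} (ha : 0 < a) (haβ : a ≤ β / 2)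
    (hb : b = ∫ y in (0 : ℝ)..(β / 2), capProfile a y) (y : ℝ) :
    Real.cos (min (latticeDist b (extremalHeight β a y)) (Real.arctan (Real.sinh a))) =
      extremalProfile β a y := by
  have hm := (extremalHeight_strictMono β a).monotone
  have h0 := latticeDist_nonneg (β / 2) y
  rw [latticeDist_extremalHeight (by linarith) hb, ← extremalHeight_of_le haβ ha.le le_rfl,
    ← hm.map_min, extremalHeight_of_le haβ (le_min h0 ha.le) (min_le_right _ _), Real.cos_arctan,
    sqrt_one_add_sinh_sq, extremalProfile, capProfile]

/-- The density is at least 1/2, so the height minus y/2 is monotone, which forces the height to ±∞.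
-/
theorem extremalHeight_surjective {β a : ℝ} (ha : 0 ≤ a) (hcosh : Real.cosh a ≤ 2) :
    Function.Surjective (extremalHeight β a) := by
  have hmono : Monotone fun y => extremalHeight β a y - 1 / 2 * y := by
    have hd : ∀ y, HasDerivAt (fun y => extremalHeight β a y - 1 / 2 * y)
        (extremalProfile β a y - 1 / 2) y := fun y =>
      (hasDerivAt_extremalHeight β a y).fun_sub (hasDerivAt_const_mul (1 / 2))
    refine monotone_of_deriv_nonneg (fun y => (hd y).differentiableAt) fun y => ?_
    rw [(hd y).deriv]
    linarith [half_le_extremalProfile (β := β) ha hcosh y]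
  have h0 : extremalHeight β a 0 = 0 := by simp [extremalHeight]
  refine (contDiff_extremalHeight β a).continuous.surjective ?_ ?_
  · refine tendsto_atTop_mono' _ ?_ (tendsto_id.const_mul_atTop (by norm_num : (0 : ℝ) < 1 / 2))
    filter_upwards [eventually_ge_atTop 0] with y hy
    have := hmono hy
    simp only [h0, id] at this ⊢
    linarith
  · refine tendsto_atBot_mono' _ ?_ (tendsto_id.const_mul_atBot (by norm_num : (0 : ℝ) < 1 / 2))
    filter_upwards [eventually_le_atBot 0] with y hy
    have := hmono hy
    simp only [h0, id] at this ⊢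
    linarith

/-- The map `x + iy ↦ x + i e(y)`. -/
noncomputable def verticalHomeomorph (e : ℝ ≃ₜ ℝ) : ℂ ≃ₜ ℂ :=
  Complex.equivRealProdCLM.toHomeomorph.trans
    (((Homeomorph.refl ℝ).prodCongr e).trans Complex.equivRealProdCLM.symm.toHomeomorph)

theorem verticalHomeomorph_apply (e : ℝ ≃ₜ ℝ) (z : ℂ) :
    verticalHomeomorph e z = ⟨z.re, e z.im⟩ := rfl

theorem verticalHomeomorph_symm (e : ℝ ≃ₜ ℝ) :
    (verticalHomeomorph e).symm = verticalHomeomorph e.symm := rfl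

theorem contDiff_verticalHomeomorph {e : ℝ ≃ₜ ℝ} (he : ContDiff ℝ 1 e) :
    ContDiff ℝ 1 (verticalHomeomorph e) :=
  Complex.equivRealProdCLM.symm.contDiff.comp
    (Complex.reCLM.contDiff.prodMk (he.comp Complex.imCLM.contDiff))

theorem fderiv_verticalHomeomorph {e : ℝ ≃ₜ ℝ} {e' : ℝ} {z : ℂ} (he : HasDerivAt e e' z.im) (v : ℂ) :
    fderiv ℝ (verticalHomeomorph e) z v = ⟨v.re, e' * v.im⟩ := by
  have h1 : HasFDerivAt (fun z : ℂ => e z.im) _ z :=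
    he.hasFDerivAt.comp z Complex.imCLM.hasFDerivAt
  have h2 : HasFDerivAt (verticalHomeomorph e) _ z :=
    Complex.equivRealProdCLM.symm.hasFDerivAt.comp z (Complex.reCLM.hasFDerivAt.prodMk h1)
  rw [h2.fderiv]
  apply Complex.ext <;> simp [mul_comm]

/-- For V with V' = p and f(V(y)) = p(y), the map (x, y) ↦ (x, V(y)) pulls f² du² + dv² back to p²
(dx² + dy²). It commutes with σ because V is odd, and carries the period 2β to 4b. -/
theorem extremal_isometric_warped {β a b : ℝ} (ha : 0 < a) (haβ : a ≤ β / 2)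
    (hcosh : Real.cosh a ≤ 2) (hb : b = ∫ y in (0 : ℝ)..(β / 2), capProfile a y) {f : ℝ → ℝ}
    (hf : ∀ v, f v = Real.cos (min (latticeDist b v) (Real.arctan (Real.sinh a)))) (hc hpos heven)
    (hper : ∀ v, f (v + 2 * (2 * b)) = f v) :
    (extremal β a).Isometric (warped (2 * b) f hc hpos heven hper) := by
  have hβ : 0 < β := by linarith
  let e : ℝ ≃ₜ ℝ := ((extremalHeight_strictMono β a).orderIsoOfSurjective _
    (extremalHeight_surjective ha.le hcosh)).toHomeomorph
  have he : ∀ y, e y = extremalHeight β a y := fun _ => rfl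
  have hd : ∀ y, HasDerivAt e (extremalProfile β a y) y := hasDerivAt_extremalHeight β a
  have hC : ContDiff ℝ 1 e := contDiff_extremalHeight β a
  refine ⟨verticalHomeomorph e, contDiff_verticalHomeomorph hC, ?_, ?_, ?_, ?_⟩
  · rw [verticalHomeomorph_symm]
    exact contDiff_verticalHomeomorph
      (e.contDiff_symm_deriv (fun y => (extremalProfile_pos β a y).ne') hd hC)
  · intro z
    apply Complex.ext <;> simp [verticalHomeomorph_apply, glide, he, extremalHeight_neg]
  · intro z
    have h := extremalHeight_add_int_mul hβ a z.im 2
    rw [← hb] at h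
    push_cast at h
    apply Complex.ext <;> simp [verticalHomeomorph_apply, vert, he, h]
  · intro z v w
    rw [fderiv_verticalHomeomorph (hd z.im), fderiv_verticalHomeomorph (hd z.im), extremal_form,
      verticalHomeomorph_apply, he]
    simp only [warped, warpedForm_apply]
    rw [hf, cos_min_latticeDist_extremalHeight ha haβ hb]
    ring

/-! ### Closed forms of the constants -/

/-- A form of the inverse Gudermannian: with sin b = tanh y and cos b = 1/cosh y the right side is
e^y. -/
theorem tan_pi_div_four_add_half {b : ℝ} (h0 : 0 < b) (h1 : b < Real.pi / 2) :
    Real.tan (Real.pi / 4 + b / 2) = (1 + Real.sin b) / Real.cos b := by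
  have hc : 0 < Real.cos b := Real.cos_pos_of_mem_Ioo ⟨by linarith, h1⟩
  have hs : 0 < Real.sin b := Real.sin_pos_of_pos_of_lt_pi h0 (by linarith)
  have h2 : 0 < Real.cos (Real.pi / 4 + b / 2) :=
    Real.cos_pos_of_mem_Ioo ⟨by linarith, by linarith⟩
  have e1 := Real.sin_two_mul (Real.pi / 4 + b / 2)
  have e2 := Real.cos_two_mul (Real.pi / 4 + b / 2)
  have e3 : 2 * (Real.pi / 4 + b / 2) = b + Real.pi / 2 := by ring
  rw [e3, Real.sin_add_pi_div_two] at e1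
  rw [e3, Real.cos_add_pi_div_two] at e2
  have e4 := Real.sin_sq_add_cos_sq (Real.pi / 4 + b / 2)
  rw [Real.tan_eq_sin_div_cos, div_eq_div_iff h2.ne' hc.ne', e1]
  linear_combination (2 * Real.cos (Real.pi / 4 + b / 2)) * e4 + Real.cos (Real.pi / 4 + b / 2) * e2

theorem cosh_log_two_add_sqrt_three : Real.cosh (Real.log (2 + √3)) = 2 := by
  have h3 : √3 ^ 2 = 3 := Real.sq_sqrt (by norm_num)
  have h0 : 0 < 2 + √3 := by positivity
  rw [Real.cosh_log h0]
  field_simp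
  linarith

theorem sinh_log_two_add_sqrt_three : Real.sinh (Real.log (2 + √3)) = √3 := by
  have h3 : √3 ^ 2 = 3 := Real.sq_sqrt (by norm_num)
  have h0 : 0 < 2 + √3 := by positivity
  rw [Real.sinh_log h0]
  field_simp
  linarith

theorem log_two_add_sqrt_three_pos : 0 < Real.log (2 + √3) :=
  Real.log_pos (by linarith [Real.sqrt_nonneg 3])

theorem arctan_sqrt_three_eq : Real.arctan (√3) = Real.pi / 3 := by
  rw [← Real.tan_pi_div_three]
  exact Real.arctan_tan (by linarith [Real.pi_pos]) (by linarith [Real.pi_pos])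

theorem sphericalConst_eq (β : ℝ) : sphericalConst β =
    Real.arctan (Real.sinh (β / 2)) / (Real.sinh (β / 2) / Real.cosh (β / 2)) := by
  have e : (Real.exp β - 1) / (Real.exp β + 1) = Real.sinh (β / 2) / Real.cosh (β / 2) := by
    have h1 : Real.exp β = Real.exp (β / 2) * Real.exp (β / 2) := by
      rw [← Real.exp_add]; congr 1; ring
    have h2 := Real.exp_pos (β / 2)
    rw [Real.sinh_eq, Real.cosh_eq, Real.exp_neg, h1]
    field_simp
  rw [sphericalConst, e, Real.arctan_eq_arcsin, sqrt_one_add_sinh_sq]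

theorem flatSphericalConst_eq (β : ℝ) : flatSphericalConst β =
    (Real.pi / 3 + (β / 2 - Real.log (2 + √3)) / 2) /
      (√3 / 2 + (β / 2 - Real.log (2 + √3)) / 2 ^ 2) := by
  rw [flatSphericalConst,
    show Real.pi / 3 + (β / 2 - Real.log (2 + √3)) / 2 =
      1 / 12 * (3 * β + 4 * Real.pi - 6 * Real.log (2 + √3)) by ring,
    show √3 / 2 + (β / 2 - Real.log (2 + √3)) / 2 ^ 2 =
      1 / 8 * (4 * √3 + β - 2 * Real.log (2 + √3)) by ring, mul_div_mul_comm]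
  norm_num

end KleinBottle

/-! ### The two ranges of conformal types -/

theorem theorem2 (β : ℝ) (hβ : 0 < β) :
    (β ≤ 2 * Real.log (2 + Real.sqrt 3) →
      (∀ g : KleinBottle.Metric β, g.IsConformal →
        g.LSigma * g.lV ≤ KleinBottle.sphericalConst β * g.vol) ∧
      ∃ (b : ℝ) (h0 : 0 < b) (h1 : b < Real.pi / 2),
        β = 2 * Real.log (Real.tan (Real.pi / 4 + b / 2)) ∧
        ∃ g : KleinBottle.Metric β, g.IsConformal ∧
          g.Isometric (KleinBottle.spherical b h0 h1) ∧
          g.LSigma * g.lV = KleinBottle.sphericalConst β * g.vol) ∧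
    (2 * Real.log (2 + Real.sqrt 3) < β →
      (∀ g : KleinBottle.Metric β, g.IsConformal →
        g.LSigma * g.lV ≤ KleinBottle.flatSphericalConst β * g.vol) ∧
      ∃ b : ℝ, Real.pi / 3 < b ∧
        β = 2 * Real.log (2 + Real.sqrt 3) + 4 * (b - Real.pi / 3) ∧
        ∃ g : KleinBottle.Metric β, g.IsConformal ∧
          g.Isometric (KleinBottle.flatSpherical b) ∧
          g.LSigma * g.lV = KleinBottle.flatSphericalConst β * g.vol) := by
  open KleinBottle in
  constructor
  · intro hle
    have ha : 0 < β / 2 := by positivity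
    have hsinh : 0 < Real.sinh (β / 2) := Real.sinh_pos_iff.2 ha
    have hcoshpos := Real.cosh_pos (β / 2)
    have hcosh : Real.cosh (β / 2) ≤ 2 := by
      refine le_of_le_of_eq (Real.cosh_le_cosh.2 ?_) cosh_log_two_add_sqrt_three
      rw [abs_of_pos ha, abs_of_pos log_two_add_sqrt_three_pos]
      linarith
    have hI := integral_capProfile_sq ha.le le_rfl
    have hb := integral_capProfile ha.le le_rfl
    rw [sub_self, zero_div, add_zero] at hI hb
    -- Here a = β/2, and b is the integral of p, the height of the edge of the cap.
    refine ⟨fun g hg => ?_, Real.arctan (Real.sinh (β / 2)), Real.arctan_pos.2 hsinh,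
      Real.arctan_lt_pi_div_two _, ?_, extremal β (β / 2), extremal_isConformal _ _, ?_, ?_⟩
    · have h := hg.LSigma_mul_lV_le ha le_rfl hcosh (Or.inl rfl)
      rw [hI, hb] at h
      rw [sphericalConst_eq, div_mul_eq_mul_div, le_div_iff₀ (by positivity)]
      exact h
    · rw [tan_pi_div_four_add_half (Real.arctan_pos.2 hsinh) (Real.arctan_lt_pi_div_two _),
        Real.sin_arctan, Real.cos_arctan, sqrt_one_add_sinh_sq]
      have : (1 + Real.sinh (β / 2) / Real.cosh (β / 2)) / (1 / Real.cosh (β / 2)) =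
          Real.exp (β / 2) := by
        rw [← Real.cosh_add_sinh]; field_simp
      rw [this, Real.log_exp]
      ring
    · refine extremal_isometric_warped ha le_rfl hcosh hb.symm (fun v => ?_) _ _ _ _
      rw [min_eq_left (latticeDist_le (Real.arctan_pos.2 hsinh) v)]
    · have h := extremal_LSigma_mul_lV ha le_rfl hcosh (Or.inl rfl)
      rw [hI, hb] at h
      rw [sphericalConst_eq, div_mul_eq_mul_div, eq_div_iff (by positivity)]
      exact h
  · intro hlt
    set a := Real.log (2 + √3) with hadef
    have ha : 0 < a := log_two_add_sqrt_three_pos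
    have haβ : a ≤ β / 2 := by linarith
    have hcosh : Real.cosh a = 2 := cosh_log_two_add_sqrt_three
    have hsinh : Real.sinh a = √3 := sinh_log_two_add_sqrt_three
    have hI := integral_capProfile_sq ha.le haβ
    have hb := integral_capProfile ha.le haβ
    rw [hsinh, hcosh] at hI hb
    rw [arctan_sqrt_three_eq] at hb
    have hIpos : 0 < √3 / 2 + (β / 2 - a) / 2 ^ 2 :=
      add_pos_of_pos_of_nonneg (by positivity) (div_nonneg (by linarith) (by positivity))
    -- Again b is the integral of p: the cap reaches latitude π/3, where the cosine is 1/2, and the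
    -- rest is a band of density 1/2.
    refine ⟨fun g hg => ?_, Real.pi / 3 + (β / 2 - a) / 2, by linarith, by ring, extremal β a,
      extremal_isConformal _ _, ?_, ?_⟩
    · have h := hg.LSigma_mul_lV_le ha haβ hcosh.le (Or.inr hcosh)
      rw [hI, hb] at h
      rw [flatSphericalConst_eq, div_mul_eq_mul_div, le_div_iff₀ hIpos]
      exact h
    · refine extremal_isometric_warped ha haβ hcosh.le hb.symm (fun v => ?_) _ _ _ _
      rw [flatSphericalProfile_eq, hsinh, arctan_sqrt_three_eq]
    · have h := extremal_LSigma_mul_lV ha haβ hcosh.le (Or.inr hcosh)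
      rw [hI, hb] at h
      rw [flatSphericalConst_eq, div_mul_eq_mul_div, eq_div_iff hIpos.ne']
      exact h
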